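/- Let $r\ge 1$ be an integer, let $\mu_r\subset\mathbb{C}$ be the group of $r$th roots of unity, and let $\mathcal{A}_r=\mathbb{Q}\langle x,y_s\mid s\in\mu_r\rangle$ be the noncommutative polynomial algebra. Put $y=y_1$, $z=x+y$, $z_s=x+y_s$ and $z_s^{\delta}=x+\delta(s)y_s$, where $\delta(1)=0$ and $\delta(s)=1$ for $s\neq 1$. Regard $\mathcal{A}_1=\mathbb{Q}\langle x,y\rangle$ as a subalgebra of $\mathcal{A}_r$, and let $\mathcal{A}_1^1=\mathbb{Q}\oplus\mathcal{A}_1y$. **The algebra $\mathcal{H}$.** Let $\mathcal{H}$ be the Connes–Kreimer Hopf algebra of (non-planar) rooted trees over $\mathbb{Q}$: it has the rooted forests as a basis, its product is disjoint union, its unit is the empty forest $\mathbb{I}$, and its coproduct $\Delta$ is the algebra homomorphism with $\Delta(B_+(f))=B_+(f)\otimes\mathbb{I}+(\mathrm{id}\otimes B_+)\Delta(f)$ for every forest $f$. Here the linear map $B_+$ sends a forest to the tree obtained by joining all its roots to one new root. **Rooted tree maps.** Consider $\mathbb{Q}$-linear maps $\mathcal{H}\to\mathrm{End}_{\mathbb{Q}}(\mathcal{A}_r)$,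 $f\mapsto\widetilde f$, with $\widetilde{\mathbb{I}}=\mathrm{id}$ such that, for all forests $f,g,h$, all $s\in\mu_r$, all $w\in\mathcal{A}_r$ and all $v\in\{z\}\cup\{z_t^{\delta}\mid t\in\mu_r\}$, 1. $\widetilde{B_+(\mathbb{I})}(z_s^{\delta})=z_s^{\delta}(z-z_s^{\delta})$ and $\widetilde{B_+(\mathbb{I})}(z)=0$; 2. if $f\ne\mathbb{I}$, then $\widetilde{f}(z_s^{\delta})\in\mathcal{A}_r(z-z_s^{\delta})$, $\widetilde{B_+(f)}(z_s^{\delta})=R_{z-z_s^{\delta}}R_{2z-z_s^{\delta}}R_{z-z_s^{\delta}}^{-1}\widetilde f(z_s^{\delta})$ and $\widetilde{B_+(f)}(z)=0$, where $R_u$ denotes right multiplication by $u$; 3. $\widetilde{gh}(v)=\widetilde g(\widetilde h(v))$; 4. $\widetilde f(wv)=\sum_{(f)}\widetilde{f'}(w)\,\widetilde{f''}(v)$, where $\Delta(f)=\sum_{(f)}f'\otimes f''$. **The diamond product.** Let $\varphi$ be the algebra automorphism of $\mathcal{A}_r$ with $\varphi(x)=z$ and $\varphi(y_s)=z_s^{\delta}-z$.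 For $s\in\mu_r$ let $\psi_s=\varphi\,\mathcal{I}\,M_s$, where, with $z_{k,t}=x^{k-1}y_t$, $\mathcal{I}$ and $M_s$ are the linear maps on $\mathcal{A}_r$ given on words by $$\mathcal{I}(z_{k_1,s_1}\cdots z_{k_l,s_l}x^a)=z_{k_1,s_1}z_{k_2,s_1s_2}\cdots z_{k_l,s_1\cdots s_l}x^a,\qquad M_s(z_{k_1,s_1}\cdots z_{k_l,s_l}x^a)=z_{k_1,ss_1}z_{k_2,s_2}\cdots z_{k_l,s_l}x^a .$$ Let $\diamond_s:\mathcal{A}_1\times\mathcal{A}_r\to\mathcal{A}_r$ be the $\mathbb{Q}$-bilinear map defined recursively, for $v\in\mathcal{A}_1$, $w\in\mathcal{A}_r$ and $1\ne t\in\mu_r$, by $$\begin{aligned} 1\diamond_s w&=w, & v\diamond_s 1&=\psi_s\varphi(v),\\ vx\diamond_s wx&=(v\diamond_s wx)x-(vy\diamond_s w)x, & vy\diamond_s wx&=(v\diamond_s wx)y+(vy\diamond_s w)x,\\ vx\diamond_s wy&=(v\diamond_s wy)x+(vx\diamond_s w)y, & vy\diamond_s wy&=(v\diamond_s wy)y-(vx\diamond_s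 w)y, \end{aligned}$$ $$\begin{aligned} vx\diamond_s wy_t&=(v\diamond_s wy_t)x+(v\diamond_s wz_t)y_t-(vy\diamond_s w)y_t,\\ vy\diamond_s wy_t&=(v\diamond_s wy_t)y-(v\diamond_s wz_t)y_t+(vy\diamond_s w)y_t . \end{aligned}$$ **Theorem.** There is exactly one linear map $f\mapsto\widetilde f$ satisfying conditions 1–4 (so the rooted tree maps $\widetilde f$ are well defined), and for every $f\in\mathcal{H}$ there exists a unique $F_f\in\mathcal{A}_1^1$ such that $$\widetilde f(z_s^{\delta}w)=z_s^{\delta}(F_f\diamond_s w)\qquad\text{for all } s\in\mu_r \text{ and all } w\in\mathcal{A}_r .$$ -/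

import Mathlib

open scoped TensorProduct

noncomputable section

/-! ### Rooted trees and rooted forests -/

/-- Plane rooted trees: a root with the list of the subtrees hanging from it. -/
inductive PlaneTree : Type
  | node : List PlaneTree → PlaneTree

/-- Elementary isomorphisms of plane rooted trees that forget the plane embedding: permute the
children of the root, or apply an elementary isomorphism inside one child. The equivalence relation
generated by this relation is isomorphism of rooted trees. -/
inductive PlaneTree.Step : PlaneTree → PlaneTree → Prop
  | perm {l l' : List PlaneTree} : l.Perm l' → PlaneTree.Step (.node l) (.node l')
  | child {a b : PlaneTree} (l : List PlaneTree) :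
      PlaneTree.Step a b → PlaneTree.Step (.node (a :: l)) (.node (b :: l))

/-- (Non-planar) rooted trees. -/
def RTree : Type := Quot PlaneTree.Step

/-- The isomorphism class of a plane tree. -/
def PlaneTree.toTree (t : PlaneTree) : RTree := Quot.mk _ t

/-- Rooted forests: finite disjoint unions of rooted trees, i.e. multisets of rooted trees. The
empty forest is `0`. -/
abbrev RForest : Type := Multiset RTree

/-- A plane representative of a rooted tree. -/
def RTree.rep (t : RTree) : PlaneTree := Quot.out t

theorem RTree.toTree_rep (t : RTree) : t.rep.toTree = t := Quot.out_eq t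

/-- Join all the roots of a forest to one new vertex, the new root
(`graft_coe` shows that this does not depend on the plane representatives). -/
def RForest.graft (m : RForest) : RTree :=
  (PlaneTree.node (m.toList.map RTree.rep)).toTree

theorem PlaneTree.toTree_perm {l l' : List PlaneTree} (h : l.Perm l') :
    (PlaneTree.node l).toTree = (PlaneTree.node l').toTree :=
  Quot.sound (.perm h)

theorem PlaneTree.toTree_cons {a b : PlaneTree} (h : a.toTree = b.toTree) (l : List PlaneTree) :
    (PlaneTree.node (a :: l)).toTree = (PlaneTree.node (b :: l)).toTree := by
  have h' : Relation.EqvGen PlaneTree.Step a b := Quot.eqvGen_exact h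
  induction h' with
  | rel _ _ h0 => exact Quot.sound (.child l h0)
  | refl => rfl
  | symm _ _ h0 ih => exact (ih (Quot.eqvGen_sound h0)).symm
  | trans _ _ _ h1 h2 ih1 ih2 =>
      exact (ih1 (Quot.eqvGen_sound h1)).trans (ih2 (Quot.eqvGen_sound h2))

theorem PlaneTree.toTree_append (p : List PlaneTree) {l l' : List PlaneTree}
    (h : l.map PlaneTree.toTree = l'.map PlaneTree.toTree) :
    (PlaneTree.node (p ++ l)).toTree = (PlaneTree.node (p ++ l')).toTree := by
  induction l generalizing p l' with
  | nil =>
      cases l' with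
      | nil => rfl
      | cons b l' => simp at h
  | cons a l ih =>
      cases l' with
      | nil => simp at h
      | cons b l' =>
          simp only [List.map_cons, List.cons.injEq] at h
          calc (PlaneTree.node (p ++ a :: l)).toTree
              = (PlaneTree.node (a :: (p ++ l))).toTree :=
                PlaneTree.toTree_perm List.perm_middle
            _ = (PlaneTree.node (b :: (p ++ l))).toTree := PlaneTree.toTree_cons h.1 _
            _ = (PlaneTree.node ((p ++ [b]) ++ l)).toTree := by
                refine PlaneTree.toTree_perm ?_
                simpa using (List.perm_middle (a := b) (l₁ := p) (l₂ := l)).symm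
            _ = (PlaneTree.node ((p ++ [b]) ++ l')).toTree := ih _ h.2
            _ = (PlaneTree.node (p ++ b :: l')).toTree := by simp

theorem RForest.graft_coe (l : List PlaneTree) :
    RForest.graft (l.map PlaneTree.toTree : List RTree) = (PlaneTree.node l).toTree := by
  have h1 : ((l.map PlaneTree.toTree : List RTree) : Multiset RTree).toList.Perm
      (l.map PlaneTree.toTree) := Multiset.coe_eq_coe.1 (by simp)
  have h2 := PlaneTree.toTree_perm (h1.map RTree.rep)
  unfold RForest.graft
  rw [h2]
  refine PlaneTree.toTree_append [] ?_
  rw [List.map_map, List.map_map]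
  exact List.map_congr_left fun t _ => RTree.toTree_rep t.toTree

/-! ### The Connes–Kreimer algebra with its coproduct -/

/-- The Connes–Kreimer algebra `ℋ`: commutative polynomials over `ℚ` in the rooted trees. As a
vector space it has the rooted forests as a basis, and the product is disjoint union. -/
abbrev CK : Type := MvPolynomial RTree ℚ

/-- A rooted forest as an element of `ℋ` (the empty forest is `1`). -/
def CK.forest (f : RForest) : CK := (f.map MvPolynomial.X).prod

/-- The grafting operator `B₊ : ℋ → ℋ`, given on the basis of forests by `RForest.graft`. -/
def CK.Bplus : CK →ₗ[ℚ] CK :=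
  (MvPolynomial.basisMonomials RTree ℚ).constr ℚ
    fun n => MvPolynomial.X (RForest.graft (Finsupp.toMultiset n))

mutual
/-- `Δ(B₊ f) = B₊ f ⊗ 1 + (id ⊗ B₊) Δ(f)`, on plane trees. -/
def PlaneTree.coprod : PlaneTree → CK ⊗[ℚ] CK
  | .node l =>
      (MvPolynomial.X (PlaneTree.node l).toTree : CK) ⊗ₜ[ℚ] (1 : CK)
        + TensorProduct.map LinearMap.id CK.Bplus (PlaneTree.coprodList l)
/-- The multiplicative extension of `PlaneTree.coprod` to ordered forests. -/
def PlaneTree.coprodList : List PlaneTree → CK ⊗[ℚ] CK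
  | [] => 1
  | t :: l => PlaneTree.coprod t * PlaneTree.coprodList l
end

theorem PlaneTree.coprodList_eq (l : List PlaneTree) :
    PlaneTree.coprodList l = (l.map PlaneTree.coprod).prod := by
  induction l with
  | nil => simp [PlaneTree.coprodList]
  | cons t l ih => simp [PlaneTree.coprodList, ih]

theorem PlaneTree.coprod_step {a b : PlaneTree} (h : PlaneTree.Step a b) :
    a.coprod = b.coprod := by
  induction h with
  | perm h =>
      rw [PlaneTree.coprod, PlaneTree.coprod, PlaneTree.coprodList_eq, PlaneTree.coprodList_eq,
        (h.map PlaneTree.coprod).prod_eq, PlaneTree.toTree_perm h]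
  | child l h ih =>
      rw [PlaneTree.coprod, PlaneTree.coprod, PlaneTree.coprodList, PlaneTree.coprodList, ih,
        PlaneTree.toTree_cons (Quot.sound h) l]

/-- The coproduct of a rooted tree. -/
def RTree.coprod : RTree → CK ⊗[ℚ] CK :=
  Quot.lift PlaneTree.coprod fun _ _ h => PlaneTree.coprod_step h

/-- The coproduct `Δ : ℋ → ℋ ⊗ ℋ`: the algebra homomorphism with
`Δ(B₊ f) = B₊ f ⊗ 1 + (id ⊗ B₊) Δ(f)`. -/
def CK.comul : CK →ₐ[ℚ] CK ⊗[ℚ] CK := MvPolynomial.aeval RTree.coprod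

theorem CK.Bplus_forest (f : RForest) :
    CK.Bplus (CK.forest f) = MvPolynomial.X f.graft := by
  classical
  have h : CK.forest f = MvPolynomial.basisMonomials RTree ℚ (Multiset.toFinsupp f) := by
    rw [MvPolynomial.coe_basisMonomials]
    induction f using Multiset.induction with
    | empty => simp [CK.forest]
    | cons t f ih =>
        have e : CK.forest (t ::ₘ f) = MvPolynomial.X t * CK.forest f := by simp [CK.forest]
        rw [e, ih, ← Multiset.singleton_add, map_add, Multiset.toFinsupp_singleton,
          MvPolynomial.X, MvPolynomial.monomial_mul, one_mul]
  rw [h, CK.Bplus, Module.Basis.constr_basis, Multiset.toFinsupp_toMultiset]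

theorem CK.comul_Bplus_forest (f : RForest) :
    CK.comul (CK.Bplus (CK.forest f)) = CK.Bplus (CK.forest f) ⊗ₜ[ℚ] (1 : CK)
      + TensorProduct.map LinearMap.id CK.Bplus (CK.comul (CK.forest f)) := by
  obtain ⟨l, rfl⟩ : ∃ l : List PlaneTree,
      f = ((l.map PlaneTree.toTree : List RTree) : Multiset RTree) := by
    refine ⟨f.toList.map RTree.rep, ?_⟩
    rw [List.map_map]
    have h : PlaneTree.toTree ∘ RTree.rep = id := funext RTree.toTree_rep
    rw [h, List.map_id, Multiset.coe_toList]
  have hc : CK.comul (CK.forest ((l.map PlaneTree.toTree : List RTree) :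
      Multiset RTree)) = PlaneTree.coprodList l := by
    rw [PlaneTree.coprodList_eq, CK.forest, map_multiset_prod]
    simp only [Multiset.map_coe, List.map_map, Multiset.prod_coe]
    congr 1
    refine List.map_congr_left fun t _ => ?_
    simp only [Function.comp, CK.comul, MvPolynomial.aeval_X]
    rfl
  rw [hc, CK.Bplus_forest, RForest.graft_coe, CK.comul, MvPolynomial.aeval_X]
  change PlaneTree.coprod (.node l) = _
  rw [PlaneTree.coprod]

/-! ### The noncommutative polynomial algebras `𝒜_r` -/

/-- The group `μ_r` of `r`th roots of unity. -/
abbrev Mu (r : ℕ) : Type := rootsOfUnity r ℂ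

/-- The letters `x` and `y_s`, `s ∈ μ_r`. -/
inductive Letter (r : ℕ) : Type
  | x : Letter r
  | y : Mu r → Letter r

/-- `𝒜_r = ℚ⟨x, y_s | s ∈ μ_r⟩`. -/
abbrev NCPoly (r : ℕ) : Type := FreeAlgebra ℚ (Letter r)

namespace NCPoly

variable {r : ℕ}

/-- The letter `x` as an element of `𝒜_r`. -/
def x : NCPoly r := FreeAlgebra.ι ℚ Letter.x

/-- The letter `y_s` as an element of `𝒜_r`. -/
def y (s : Mu r) : NCPoly r := FreeAlgebra.ι ℚ (Letter.y s)

/-- `z = x + y_1`. -/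
def z : NCPoly r := x + y 1

open Classical in
/-- `z_s^δ = x + δ(s) y_s`, where `δ(1) = 0` and `δ(s) = 1` for `s ≠ 1`. -/
def zd (s : Mu r) : NCPoly r := x + (if s = 1 then 0 else 1 : ℚ) • y s

/-- The word with a given list of letters. -/
def word (w : List (Letter r)) : NCPoly r := (w.map (FreeAlgebra.ι ℚ)).prod

/-- The linear extension of a map given on words. -/
def onWords {V : Type*} [AddCommGroup V] [Module ℚ V] (g : List (Letter r) → V) :
    NCPoly r →ₗ[ℚ] V :=
  (FreeAlgebra.basisFreeMonoid ℚ (Letter r)).constr ℚ fun w => g w.toList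

theorem onWords_word {V : Type*} [AddCommGroup V] [Module ℚ V] (g : List (Letter r) → V)
    (w : List (Letter r)) : onWords g (word w) = g w := by
  have h : word w = FreeAlgebra.basisFreeMonoid ℚ (Letter r) (FreeMonoid.ofList w) := by
    simp [FreeAlgebra.basisFreeMonoid, word, FreeAlgebra.equivMonoidAlgebraFreeMonoid,
      FreeMonoid.lift_apply]
  rw [h, onWords, Module.Basis.constr_basis]
  rfl

variable (r) in
/-- `𝒜_r^1 = ℚ ⊕ ⨁_s 𝒜_r y_s`. -/
def one1 : Submodule ℚ (NCPoly r) :=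
  Submodule.span ℚ {1} ⊔ ⨆ s : Mu r, LinearMap.range (LinearMap.mulRight ℚ (y s))

/-- The automorphism `φ` of `𝒜_r` with `φ(x) = z` and `φ(y_s) = z_s^δ - z`. -/
def phi : NCPoly r →ₐ[ℚ] NCPoly r :=
  FreeAlgebra.lift ℚ fun
    | .x => z
    | .y s => zd s - z

/-- Read a word from the left and replace the label of each `y` by `c` times the product of all the
labels up to and including its own. -/
def cumulate (c : Mu r) : List (Letter r) → List (Letter r)
  | [] => []
  | .x :: w => .x :: cumulate c w
  | .y s :: w => .y (c * s) :: cumulate (c * s) w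

/-- Multiply the label of the first `y` of a word by `s`. -/
def scaleFirst (s : Mu r) : List (Letter r) → List (Letter r)
  | [] => []
  | .x :: w => .x :: scaleFirst s w
  | .y t :: w => .y (s * t) :: w

/-- The linear map `ℐ`:
`z_{k₁,s₁} z_{k₂,s₂} ⋯ z_{k_l,s_l} x^a ↦ z_{k₁,s₁} z_{k₂,s₁s₂} ⋯ z_{k_l,s₁⋯s_l} x^a`. -/
def calI : NCPoly r →ₗ[ℚ] NCPoly r := onWords fun w => word (cumulate 1 w)

/-- The linear map `M_s`:
`z_{k₁,s₁} z_{k₂,s₂} ⋯ z_{k_l,s_l} x^a ↦ z_{k₁,ss₁} z_{k₂,s₂} ⋯ z_{k_l,s_l} x^a`. -/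
def calM (s : Mu r) : NCPoly r →ₗ[ℚ] NCPoly r := onWords fun w => word (scaleFirst s w)

/-- `ψ_s = φ ℐ M_s`. -/
def psi (s : Mu r) : NCPoly r →ₗ[ℚ] NCPoly r := phi.toLinearMap ∘ₗ calI ∘ₗ calM s

variable (r) in
/-- The inclusion of `𝒜_1 = ℚ⟨x, y_1⟩` into `𝒜_r`. -/
def incl : NCPoly 1 →ₐ[ℚ] NCPoly r :=
  FreeAlgebra.lift ℚ fun
    | .x => x
    | .y _ => y 1

open Classical in
/-- The product `v ◇_s w` of a word `v` of `𝒜_1` and a word `w` of `𝒜_r`, **both given by the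
list of their letters from right to left**. -/
def diamondRev (s : Mu r) : List (Letter 1) → List (Letter r) → NCPoly r
  | [], w => word w.reverse
  | a :: v, [] => psi s (incl r (phi (word (a :: v).reverse)))
  | .x :: v, .x :: w =>
      diamondRev s v (.x :: w) * x - diamondRev s (.y 1 :: v) w * x
  | .y _ :: v, .x :: w =>
      diamondRev s v (.x :: w) * y 1 + diamondRev s (.y 1 :: v) w * x
  | .x :: v, .y t :: w =>
      if t = 1 then
        diamondRev s v (.y 1 :: w) * x + diamondRev s (.x :: v) w * y 1
      else
        diamondRev s v (.y t :: w) * x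
          + (diamondRev s v (.x :: w) + diamondRev s v (.y t :: w)) * y t
          - diamondRev s (.y 1 :: v) w * y t
  | .y _ :: v, .y t :: w =>
      if t = 1 then
        diamondRev s v (.y 1 :: w) * y 1 - diamondRev s (.x :: v) w * y 1
      else
        diamondRev s v (.y t :: w) * y 1
          - (diamondRev s v (.x :: w) + diamondRev s v (.y t :: w)) * y t
          + diamondRev s (.y 1 :: v) w * y t
  termination_by v w => v.length + w.length

/-- The diamond product `◇_s : 𝒜_1 × 𝒜_r → 𝒜_r`, the bilinear map with (`z_t = x + y_t`)
* `1 ◇ w = w` and `v ◇ 1 = ψ_s φ(v)`,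
* `vx ◇ wx = (v ◇ wx)x - (vy ◇ w)x` and `vy ◇ wx = (v ◇ wx)y + (vy ◇ w)x`,
* `vx ◇ wy = (v ◇ wy)x + (vx ◇ w)y` and `vy ◇ wy = (v ◇ wy)y - (vx ◇ w)y`,
* `vx ◇ wy_t = (v ◇ wy_t)x + (v ◇ wz_t)y_t - (vy ◇ w)y_t` for `t ≠ 1`,
* `vy ◇ wy_t = (v ◇ wy_t)y - (v ◇ wz_t)y_t + (vy ◇ w)y_t` for `t ≠ 1`. -/
def diamond (s : Mu r) : NCPoly 1 →ₗ[ℚ] NCPoly r →ₗ[ℚ] NCPoly r :=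
  onWords fun v => onWords fun w => diamondRev s v.reverse w.reverse

/-! ### Rooted tree maps -/

variable (r) in
/-- The set `{z} ∪ {z_s^δ | s ∈ μ_r}`. -/
def zLetters : Set (NCPoly r) := insert z (Set.range zd)

/-- The defining conditions of the assignment `f ↦ f̃` of rooted tree maps, as a linear map
`ℋ → End_ℚ(𝒜_r)`. -/
structure IsRootedTreeMap (T : CK →ₗ[ℚ] Module.End ℚ (NCPoly r)) : Prop where
  /-- The identity map is assigned to the empty forest. -/
  empty : T (CK.forest 0) = LinearMap.id
  /-- For the one-vertex tree `B₊ 1`: `z_s^δ ↦ z_s^δ (z - z_s^δ)` and `z ↦ 0`. -/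
  vertex_zd : ∀ s : Mu r, T (CK.Bplus (CK.forest 0)) (zd s) = zd s * (z - zd s)
  vertex_z : T (CK.Bplus (CK.forest 0)) z = 0
  /-- `(B₊ f)~ (z_s^δ) = R_{z - z_s^δ} R_{2z - z_s^δ} R_{z - z_s^δ}⁻¹ f̃(z_s^δ)`, where
  `R_w` is right multiplication by `w`; the polynomial `u` is `R_{z - z_s^δ}⁻¹ f̃(z_s^δ)`. -/
  graft_zd : ∀ f : RForest, f ≠ 0 → ∀ s : Mu r, ∃ u : NCPoly r,
    T (CK.forest f) (zd s) = u * (z - zd s) ∧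
    T (CK.Bplus (CK.forest f)) (zd s) = u * (2 * z - zd s) * (z - zd s)
  graft_z : ∀ f : RForest, f ≠ 0 → T (CK.Bplus (CK.forest f)) z = 0
  /-- `(gh)~ (v) = g̃(h̃(v))`. -/
  mul : ∀ g h : RForest, ∀ v ∈ zLetters r,
    T (CK.forest (g + h)) v = T (CK.forest g) (T (CK.forest h) v)
  /-- `f̃(wv) = ∑ a~(w) b~(v)`, where `Δ(f) = ∑ a ⊗ b`. -/
  concat : ∀ f : RForest, ∀ w : NCPoly r, ∀ v ∈ zLetters r,
    T (CK.forest f) (w * v) =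
      LinearMap.mul' ℚ (NCPoly r)
        (TensorProduct.map (T.flip w) (T.flip v) (CK.comul (CK.forest f)))

end NCPoly

end

open scoped TensorProduct

noncomputable section

namespace NCPoly

variable {r : ℕ}

/-! ### Induction principles for words -/

-- Conjugating by the involution φ turns ◇_s into a harmonic (quasi-shuffle) product. Write u * w
-- for `star s u w` = φ(φ(u) ◇_s φ(w)). The recursions collapse to three rules: a final x of either
-- factor passes out to the right, v * 1 is v with every y relabelled y_s, and uy * wy_t = (u * wy_t
-- + uy * w + (u * w)x) y_t. Hence `star 1` on 𝒜_1 is commutative and associative, and every `star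
-- s` makes 𝒜_r a module over it (`star_comm`, `star_star`).
--
-- As ℋ is a free commutative algebra, there is an algebra homomorphism from ℋ to 𝒜_1 with the
-- harmonic product that carries B₊ to `graftOp`; `CK.gen` is its underlying linear map. Let g in
-- 𝒜_1 act on 𝒜_r by `leftAct`, so that (x + y_s)w goes to (x + y_s)(g * w). Since φ exchanges z_s^δ
-- and x + y_s, the maps f̃ = φ ∘ leftAct(gen f) ∘ φ satisfy the required formula with F_f = φ(gen
-- f). Condition 3 is the module law, and the factor 2z - z_s^δ of condition 2 is φ(x - y_s).
--
-- The serious point is condition 4. By `leftAct_graftOp_mul_y`, the change of the operator of B₊(f)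
-- when y_t is appended to a word is determined by the operator of f. Summing this over Δ(f) gives
-- the same relation for the coproduct side, so the Leibniz rule passes from f to B₊(f) by induction
-- on the last letter (`Leibniz.graft`); it passes to products because Δ and the action are
-- multiplicative.
--
-- For uniqueness of f̃, induct on the number of vertices: two solutions agreeing on smaller forests
-- have a difference D with D(wv) = D(w)v for each letter v, and D(1) = 0. Uniqueness of F_f follows
-- from w = 1, because v ↦ v ◇_s 1 is injective.

theorem right_induction {P : NCPoly r → Prop} (one : P 1)
    (mul_x : ∀ w, P w → P (w * x)) (mul_y : ∀ w t, P w → P (w * y t))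
    (add : ∀ v w, P v → P w → P (v + w)) (smul : ∀ (c : ℚ) w, P w → P (c • w)) (w : NCPoly r) :
    P w := by
  have key : ∀ a : NCPoly r, ∀ w, P w → P (w * a) := by
    intro a
    induction a using FreeAlgebra.induction with
    | grade0 c => intro w hw; rw [← Algebra.commutes, ← Algebra.smul_def]; exact smul c w hw
    | grade1 l =>
        intro w hw
        cases l with
        | x => exact mul_x w hw
        | y t => exact mul_y w t hw
    | mul a b ha hb => intro w hw; rw [← mul_assoc]; exact hb _ (ha _ hw)
    | add a b ha hb => intro w hw; rw [mul_add]; exact add _ _ (ha _ hw) (hb _ hw)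
  simpa using key w 1 one

/-- The generators x and x + y_t replace x and y_t because `leftAct` is described by its behaviour
on left multiples of these. -/
theorem left_induction {P : NCPoly r → Prop} (one : P 1)
    (x_mul : ∀ w, P w → P (x * w)) (z_mul : ∀ w t, P w → P ((x + y t) * w))
    (add : ∀ v w, P v → P w → P (v + w)) (smul : ∀ (c : ℚ) w, P w → P (c • w)) (w : NCPoly r) :
    P w := by
  have key : ∀ a : NCPoly r, ∀ w, P w → P (a * w) := by
    intro a
    induction a using FreeAlgebra.induction with
    | grade0 c => intro w hw; rw [← Algebra.smul_def]; exact smul c w hw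
    | grade1 l =>
        intro w hw
        cases l with
        | x => exact x_mul w hw
        | y t =>
            have h : FreeAlgebra.ι ℚ (Letter.y t) * w = (x + y t) * w + (-1 : ℚ) • (x * w) := by
              rw [neg_one_smul, add_mul, y]; abel
            rw [h]
            exact add _ _ (z_mul w t hw) (smul _ _ (x_mul w hw))
    | mul a b ha hb => intro w hw; rw [mul_assoc]; exact ha _ (hb _ hw)
    | add a b ha hb => intro w hw; rw [add_mul]; exact add _ _ (ha _ hw) (hb _ hw)
  simpa using key w 1 one

@[simp] theorem word_nil : word ([] : List (Letter r)) = 1 := rfl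

theorem word_cons (a : Letter r) (l : List (Letter r)) :
    word (a :: l) = FreeAlgebra.ι ℚ a * word l := by simp [word]

theorem word_concat_x (l : List (Letter r)) : word (l ++ [.x]) = word l * x := by
  simp [word, x]

theorem word_concat_y (l : List (Letter r)) (t : Mu r) : word (l ++ [.y t]) = word l * y t := by
  simp [word, y]

theorem word_induction {P : NCPoly r → Prop} (word : ∀ l, P (word l))
    (add : ∀ v w, P v → P w → P (v + w)) (smul : ∀ (c : ℚ) w, P w → P (c • w)) (w : NCPoly r) :
    P w := by
  have h : w ∈ Submodule.span ℚ (Set.range (NCPoly.word (r := r))) := by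
    induction w using right_induction with
    | one => exact Submodule.subset_span ⟨[], rfl⟩
    | mul_x w hw =>
        induction hw using Submodule.span_induction with
        | mem _ h =>
            obtain ⟨l, rfl⟩ := h
            exact Submodule.subset_span ⟨_, word_concat_x l⟩
        | zero => simp
        | add _ _ _ _ h1 h2 => rw [add_mul]; exact add_mem h1 h2
        | smul c _ _ h => rw [smul_mul_assoc]; exact Submodule.smul_mem _ _ h
    | mul_y w t hw =>
        induction hw using Submodule.span_induction with
        | mem _ h =>
            obtain ⟨l, rfl⟩ := h
            exact Submodule.subset_span ⟨_, word_concat_y l t⟩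
        | zero => simp
        | add _ _ _ _ h1 h2 => rw [add_mul]; exact add_mem h1 h2
        | smul c _ _ h => rw [smul_mul_assoc]; exact Submodule.smul_mem _ _ h
    | add _ _ h1 h2 => exact add_mem h1 h2
    | smul c _ h => exact Submodule.smul_mem _ _ h
  induction h using Submodule.span_induction with
  | mem _ h => obtain ⟨l, rfl⟩ := h; exact word l
  | zero => simpa using smul 0 _ (word [])
  | add _ _ _ _ h1 h2 => exact add _ _ h1 h2
  | smul c _ _ h => exact smul c _ h

theorem word_induction₂ {P : NCPoly 1 → NCPoly r → Prop} (word : ∀ l m, P (word l) (word m))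
    (add_left : ∀ v v' w, P v w → P v' w → P (v + v') w)
    (smul_left : ∀ (c : ℚ) v w, P v w → P (c • v) w)
    (add_right : ∀ v w w', P v w → P v w' → P v (w + w'))
    (smul_right : ∀ (c : ℚ) v w, P v w → P v (c • w)) (v : NCPoly 1) (w : NCPoly r) : P v w :=
  word_induction (P := fun v => P v w)
    (fun l => word_induction (word l) (fun _ _ => add_right _ _ _) (fun c _ => smul_right c _ _) w)
    (fun _ _ => add_left _ _ w) (fun c _ => smul_left c _ w) v

/-! ### The recursion of the diamond product -/

theorem diamond_word (s : Mu r) (l : List (Letter 1)) (m : List (Letter r)) :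
    diamond s (word l) (word m) = diamondRev s l.reverse m.reverse := by
  rw [diamond, onWords_word, onWords_word]

@[simp] theorem diamond_one_left (s : Mu r) (w : NCPoly r) : diamond s 1 w = w := by
  induction w using word_induction with
  | word m => rw [← word_nil, diamond_word]; simp [diamondRev]
  | add v w hv hw => rw [map_add, hv, hw]
  | smul c w hw => rw [map_smul, hw]

theorem diamond_one_right (s : Mu r) (v : NCPoly 1) :
    diamond s v 1 = psi s (incl r (phi v)) := by
  induction v using word_induction with
  | word l =>
      rw [← word_nil, diamond_word]
      rcases List.eq_nil_or_concat l with rfl | ⟨l, a, rfl⟩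
      -- Here the clause 1 ◇ w = w of `diamondRev` applies, so its agreement with ψ_s φ(1) has to be
      -- checked.
      · have h : (1 : NCPoly r) = word [] := rfl
        simp only [List.reverse_nil, diamondRev, word_nil, map_one]
        simp only [psi, LinearMap.comp_apply, h, calM, onWords_word, scaleFirst, calI, cumulate]
        simp
      · simp [diamondRev]
  | add v w hv hw => simp only [map_add, LinearMap.add_apply, hv, hw]
  | smul c w hw => simp only [map_smul, LinearMap.smul_apply, hw]

theorem diamond_x_x (s : Mu r) (v : NCPoly 1) (w : NCPoly r) :
    diamond s (v * x) (w * x) = diamond s v (w * x) * x - diamond s (v * y 1) w * x := by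
  induction v, w using word_induction₂ with
  | word l m =>
      simp only [← word_concat_x, ← word_concat_y, diamond_word, List.reverse_append,
        List.reverse_singleton, List.singleton_append, diamondRev]
  | _ => simp only [add_mul, smul_mul_assoc, map_add, map_smul, LinearMap.add_apply,
      LinearMap.smul_apply, smul_sub, *]; try abel

theorem diamond_y_x (s : Mu r) (v : NCPoly 1) (w : NCPoly r) :
    diamond s (v * y 1) (w * x) = diamond s v (w * x) * y 1 + diamond s (v * y 1) w * x := by
  induction v, w using word_induction₂ with
  | word l m =>
      simp only [← word_concat_x, ← word_concat_y, diamond_word, List.reverse_append,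
        List.reverse_singleton, List.singleton_append, diamondRev]
  | _ => simp only [add_mul, smul_mul_assoc, map_add, map_smul, LinearMap.add_apply,
      LinearMap.smul_apply, smul_add, *]; try abel

theorem diamond_x_y (s : Mu r) (v : NCPoly 1) (w : NCPoly r) :
    diamond s (v * x) (w * y 1) = diamond s v (w * y 1) * x + diamond s (v * x) w * y 1 := by
  induction v, w using word_induction₂ with
  | word l m =>
      simp only [← word_concat_x, ← word_concat_y, diamond_word, List.reverse_append,
        List.reverse_singleton, List.singleton_append, diamondRev, if_true]
  | _ => simp only [add_mul, smul_mul_assoc, map_add, map_smul, LinearMap.add_apply,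
      LinearMap.smul_apply, smul_add, *]; try abel

theorem diamond_y_y (s : Mu r) (v : NCPoly 1) (w : NCPoly r) :
    diamond s (v * y 1) (w * y 1) = diamond s v (w * y 1) * y 1 - diamond s (v * x) w * y 1 := by
  induction v, w using word_induction₂ with
  | word l m =>
      simp only [← word_concat_x, ← word_concat_y, diamond_word, List.reverse_append,
        List.reverse_singleton, List.singleton_append, diamondRev, if_true]
  | _ => simp only [add_mul, smul_mul_assoc, map_add, map_smul, LinearMap.add_apply,
      LinearMap.smul_apply, smul_sub, *]; try abel

theorem diamond_x_y_of_ne (s : Mu r) {t : Mu r} (ht : t ≠ 1) (v : NCPoly 1) (w : NCPoly r) :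
    diamond s (v * x) (w * y t) = diamond s v (w * y t) * x
      + (diamond s v (w * x) + diamond s v (w * y t)) * y t - diamond s (v * y 1) w * y t := by
  induction v, w using word_induction₂ with
  | word l m =>
      simp only [← word_concat_x, ← word_concat_y, diamond_word, List.reverse_append,
        List.reverse_singleton, List.singleton_append, diamondRev, if_neg ht]
  | _ => simp only [add_mul, smul_mul_assoc, map_add, map_smul, LinearMap.add_apply,
      LinearMap.smul_apply, smul_sub, smul_add, *]; try abel

theorem diamond_y_y_of_ne (s : Mu r) {t : Mu r} (ht : t ≠ 1) (v : NCPoly 1) (w : NCPoly r) :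
    diamond s (v * y 1) (w * y t) = diamond s v (w * y t) * y 1
      - (diamond s v (w * x) + diamond s v (w * y t)) * y t + diamond s (v * y 1) w * y t := by
  induction v, w using word_induction₂ with
  | word l m =>
      simp only [← word_concat_x, ← word_concat_y, diamond_word, List.reverse_append,
        List.reverse_singleton, List.singleton_append, diamondRev, if_neg ht]
  | _ => simp only [add_mul, smul_mul_assoc, map_add, map_smul, LinearMap.add_apply,
      LinearMap.smul_apply, smul_sub, smul_add, *]; try abel

/-! ### The involution `φ` -/

@[simp] theorem phi_x : phi (x : NCPoly r) = z := by simp [phi, x]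

@[simp] theorem phi_y (t : Mu r) : phi (y t) = zd t - z := by simp [phi, y]

@[simp] theorem zd_one : zd (1 : Mu r) = x := by simp [zd]

theorem zd_of_ne {t : Mu r} (ht : t ≠ 1) : zd t = x + y t := by simp [zd, ht]

theorem phi_zd (t : Mu r) : phi (zd t) = x + y t := by
  by_cases ht : t = 1
  · subst ht; simp [z]
  · rw [zd_of_ne ht]; simp [zd_of_ne ht]

@[simp] theorem phi_z : phi (z : NCPoly r) = x := by simp [z]

-- φ exchanges x with z and z_t^δ with x + y_t, and these elements generate.
@[simp] theorem phi_phi (w : NCPoly r) : phi (phi w) = w := by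
  have h : (phi (r := r)).comp phi = AlgHom.id ℚ _ := by
    ext a
    cases a with
    | x => change phi (phi x) = x; simp
    | y t => change phi (phi (y t)) = y t; simp [phi_zd]
  exact DFunLike.congr_fun h w

theorem phi_x_add_y (t : Mu r) : phi (x + y t) = zd t := by rw [← phi_zd, phi_phi]

theorem y_eq (t : Mu 1) : y t = y 1 := by rw [Subsingleton.elim t 1]

theorem phi_y_one : phi (y 1 : NCPoly r) = - y 1 := by simp [z]

/-- The algebra homomorphism `𝒜_1 → 𝒜_r` with `x ↦ x` and `y ↦ y_s`. -/
def sigma (s : Mu r) : NCPoly 1 →ₐ[ℚ] NCPoly r :=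
  FreeAlgebra.lift ℚ fun
    | .x => x
    | .y _ => y s

@[simp] theorem sigma_x (s : Mu r) : sigma s x = x := by simp [sigma, x]

@[simp] theorem sigma_y (s : Mu r) (t : Mu 1) : sigma s (y t) = y s := by simp [sigma, y]

/-- Label every `y` of a word by `s`. -/
def relabel (s : Mu r) : Letter 1 → Letter r
  | .x => .x
  | .y _ => .y s

theorem sigma_word (s : Mu r) (l : List (Letter 1)) :
    sigma s (word l) = word (l.map (relabel s)) := by
  induction l with
  | nil => simp
  | cons a l ih =>
      rw [List.map_cons, word_cons, word_cons, map_mul, ih]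
      congr 1
      cases a with
      | x => exact sigma_x s
      | y t => exact sigma_y s t

theorem incl_eq_sigma : incl r = sigma 1 := rfl

theorem cumulate_relabel (s : Mu r) (l : List (Letter 1)) :
    cumulate s (l.map (relabel 1)) = l.map (relabel s) := by
  induction l with
  | nil => rfl
  | cons a l ih => cases a <;> simp [relabel, cumulate, ih]

theorem cumulate_scaleFirst_relabel (s : Mu r) (l : List (Letter 1)) :
    cumulate 1 (scaleFirst s (l.map (relabel 1))) = l.map (relabel s) := by
  induction l with
  | nil => rfl
  | cons a l ih => cases a <;> simp [relabel, cumulate, scaleFirst, ih, cumulate_relabel]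

/-- All labels in the image of 𝒜_1 are 1. After M_s the first label is s and the rest are 1, so
every partial product taken by ℐ equals s. -/
theorem psi_incl (s : Mu r) (v : NCPoly 1) : psi s (incl r v) = phi (sigma s v) := by
  induction v using word_induction with
  | word l =>
      rw [incl_eq_sigma, sigma_word, sigma_word, ← cumulate_scaleFirst_relabel s]
      simp only [psi, LinearMap.comp_apply, calM, calI, onWords_word]
      rfl
  | add v w hv hw => simp only [map_add, hv, hw]
  | smul c w hw => simp only [map_smul, hw]

/-- In the sum of the rules for vx and vy, all terms with a shortened right factor cancel. -/
theorem diamond_mul_z_left (s : Mu r) (v : NCPoly 1) (w : NCPoly r) :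
    diamond s (v * z) w = diamond s v w * z := by
  induction w using right_induction with
  | one =>
      simp only [diamond_one_right, psi_incl]
      simp
  | mul_x w _ => simp only [z, mul_add, map_add, LinearMap.add_apply, diamond_x_x, diamond_y_x]; abel
  | mul_y w t _ =>
      by_cases ht : t = 1
      · subst ht
        simp only [z, mul_add, map_add, LinearMap.add_apply, diamond_x_y, diamond_y_y]; abel
      · simp only [z, mul_add, map_add, LinearMap.add_apply, diamond_x_y_of_ne s ht,
          diamond_y_y_of_ne s ht]
        abel
  | add v w hv hw => simp only [map_add, add_mul, hv, hw]
  | smul c w hw => simp only [map_smul, smul_mul_assoc, hw]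

/-- For vx, the induction hypothesis produces (v ◇ w)zx. The left rule rewrites (v ◇ w)z as vx ◇ w +
vy ◇ w, and the second part cancels the correction term. The case of vy is similar. -/
theorem diamond_mul_z_right (s : Mu r) (v : NCPoly 1) (w : NCPoly r) :
    diamond s v (w * z) = diamond s v w * z := by
  induction v using right_induction with
  | one => simp
  | mul_x v hv =>
      have h := diamond_mul_z_left s v w
      simp only [z, mul_add, map_add, LinearMap.add_apply, diamond_x_x, diamond_x_y] at hv h ⊢
      linear_combination (norm := noncomm_ring) hv * x - h * x
  | mul_y v t hv =>
      have h := diamond_mul_z_left s v w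
      rw [y_eq t]
      simp only [z, mul_add, map_add, LinearMap.add_apply, diamond_y_x, diamond_y_y] at hv h ⊢
      linear_combination (norm := noncomm_ring) hv * y 1 - h * y 1
  | add v v' hv hw => simp only [map_add, LinearMap.add_apply, add_mul, hv, hw]
  | smul c w hw => simp only [map_smul, LinearMap.smul_apply, smul_mul_assoc, hw]

/-- Using φ(y_t) in place of y_t merges the cases t = 1 and t ≠ 1 into one formula, which becomes
`star_y_y` after conjugation. -/
theorem diamond_y_mul_phi_y (s t : Mu r) (v : NCPoly 1) (w : NCPoly r) :
    diamond s (v * y 1) (w * phi (y t)) = (diamond s (v * y 1) w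
      - diamond s v (w * phi (y t)) - diamond s v w * z) * phi (y t) := by
  have h1 := diamond_mul_z_left s v w
  have h2 := diamond_mul_z_right s v w
  by_cases ht : t = 1
  · subst ht
    simp only [phi_y_one, mul_neg, map_neg, diamond_y_y]
    simp only [z, mul_add, map_add, LinearMap.add_apply] at h1 h2 ⊢
    linear_combination (norm := noncomm_ring) h1 * y 1
  · have e : phi (y t) = y t - y 1 := by rw [phi_y, zd_of_ne ht, z]; abel
    simp only [e, mul_sub, map_sub, diamond_y_y, diamond_y_y_of_ne s ht]
    simp only [z, mul_add, map_add, LinearMap.add_apply] at h1 h2 ⊢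
    linear_combination (norm := noncomm_ring) h1 * y 1 - h2 * y t

/-! ### The harmonic product -/

/-- The diamond product conjugated by `φ`. -/
def star (s : Mu r) : NCPoly 1 →ₗ[ℚ] NCPoly r →ₗ[ℚ] NCPoly r :=
  ((diamond s).compl₁₂ phi.toLinearMap phi.toLinearMap).compr₂ phi.toLinearMap

theorem star_apply (s : Mu r) (v : NCPoly 1) (w : NCPoly r) :
    star s v w = phi (diamond s (phi v) (phi w)) := rfl

@[simp] theorem star_one_left (s : Mu r) (w : NCPoly r) : star s 1 w = w := by
  simp [star_apply]

@[simp] theorem star_one_right (s : Mu r) (v : NCPoly 1) : star s v 1 = sigma s v := by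
  simp [star_apply, diamond_one_right, psi_incl]

@[simp] theorem star_mul_x_left (s : Mu r) (v : NCPoly 1) (w : NCPoly r) :
    star s (v * x) w = star s v w * x := by
  simp [star_apply, diamond_mul_z_left]

@[simp] theorem star_mul_x_right (s : Mu r) (v : NCPoly 1) (w : NCPoly r) :
    star s v (w * x) = star s v w * x := by
  simp [star_apply, diamond_mul_z_right]

theorem star_y_y (s t : Mu r) (v : NCPoly 1) (w : NCPoly r) :
    star s (v * y 1) (w * y t)
      = (star s v (w * y t) + star s (v * y 1) w + star s v w * x) * y t := by
  have h := diamond_y_mul_phi_y s t (phi v) (phi w)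
  simp only [star_apply, map_mul, phi_y_one, mul_neg, map_neg, LinearMap.neg_apply, h, phi_z,
    map_sub, phi_phi]
  noncomm_ring


-- Associativity, commutativity and module structure of the harmonic product.

@[simp] theorem sigma_one_eq (v : NCPoly 1) : sigma 1 v = v := by
  have h : sigma (1 : Mu 1) = AlgHom.id ℚ _ := by
    ext a
    cases a with
    | x => exact sigma_x 1
    | y t => exact (sigma_y 1 t).trans (y_eq t).symm
  rw [h, AlgHom.id_apply]

/-- As σ_s(v) = v * 1, this is the case w = 1 of `star_star`, where it serves as a base case. -/
theorem sigma_star (s : Mu r) (u v : NCPoly 1) :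
    sigma s (star 1 u v) = star s u (sigma s v) := by
  induction u using right_induction generalizing v with
  | one => simp
  | mul_x u hu => simp [hu]
  | mul_y u t hu =>
      rw [y_eq t]
      induction v using right_induction with
      | one => simp
      | mul_x v hv => simp [hv]
      | mul_y v t hv =>
          rw [y_eq t, star_y_y, map_mul (sigma s), map_add (sigma s), map_add (sigma s),
            map_mul (sigma s), hu, hu, hv]
          simp only [map_mul (sigma s), sigma_y, sigma_x, star_y_y]
      | add v v' h h' => simp only [map_add, h, h']
      | smul c v h => simp only [map_smul, h]
  | add u u' h h' => simp only [map_add, LinearMap.add_apply, h, h']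
  | smul c u h => simp only [map_smul, LinearMap.smul_apply, h]

theorem star_star (s : Mu r) (u v : NCPoly 1) (w : NCPoly r) :
    star s (star 1 u v) w = star s u (star s v w) := by
  induction u using right_induction generalizing v w with
  | one => simp
  | mul_x u hu => simp [hu]
  | mul_y u t hu =>
      rw [y_eq t]
      induction v using right_induction generalizing w with
      | one => simp only [star_one_right, sigma_one_eq, star_one_left]
      | mul_x v hv => simp [hv]
      | mul_y v t hv =>
          rw [y_eq t]
          induction w using right_induction with
          | one => simp [sigma_star]
          | mul_x w hw => simp [hw]
          | mul_y w t hw =>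
              -- After the outer product is expanded, `e` is used backwards to restore uy * vy, so
              -- that the induction hypothesis on w applies. The inner product with wy_t on the
              -- other side is restored in the same way.
              have e := star_y_y 1 1 u v
              rw [e, star_y_y, ← e, hw, star_y_y, star_y_y, ← star_y_y s t v w]
              simp only [map_add, LinearMap.add_apply, star_mul_x_left, star_mul_x_right, hu, hv,
                add_mul]
              abel
          | add v v' h h' => simp only [map_add, h, h']
          | smul c v h => simp only [map_smul, h]
      | add v v' h h' => simp only [map_add, LinearMap.add_apply, h, h']
      | smul c v h => simp only [map_smul, LinearMap.smul_apply, h]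
  | add u u' h h' => simp only [map_add, LinearMap.add_apply, h, h']
  | smul c u h => simp only [map_smul, LinearMap.smul_apply, h]

theorem star_comm (u v : NCPoly 1) : star 1 u v = star 1 v u := by
  induction u using right_induction generalizing v with
  | one => simp
  | mul_x u hu => simp [hu]
  | mul_y u t hu =>
      rw [y_eq t]
      induction v using right_induction with
      | one => simp
      | mul_x v hv => simp [hv]
      | mul_y v t hv =>
          rw [y_eq t, star_y_y, star_y_y, hu, hu, hv, add_comm (star 1 (v * y 1) u)]
      | add v v' h h' => simp only [map_add, LinearMap.add_apply, h, h']
      | smul c v h => simp only [map_smul, LinearMap.smul_apply, h]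
  | add u u' h h' => simp only [map_add, LinearMap.add_apply, h, h']
  | smul c u h => simp only [map_smul, LinearMap.smul_apply, h]

/-- The constant term of a noncommutative polynomial. -/
def constTerm : NCPoly 1 →ₐ[ℚ] ℚ := FreeAlgebra.lift ℚ fun _ => 0

@[simp] theorem constTerm_x : constTerm x = 0 := by simp [constTerm, x]

@[simp] theorem constTerm_y (t : Mu 1) : constTerm (y t) = 0 := by simp [constTerm, y]

theorem constTerm_star (u v : NCPoly 1) :
    constTerm (star 1 u v) = constTerm u * constTerm v := by
  induction u using right_induction generalizing v with
  | one => simp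
  | mul_x u hu => simp
  | mul_y u t hu =>
      rw [y_eq t]
      induction v using right_induction with
      | one => simp
      | mul_x v hv => simp
      | mul_y v t hv => rw [star_y_y]; simp
      | add v v' h h' => simp only [map_add, mul_add, h, h']
      | smul c v h => simp only [map_smul, h, smul_eq_mul]; ring
  | add u u' h h' => simp only [map_add, LinearMap.add_apply, add_mul, h, h']
  | smul c u h => simp only [map_smul, LinearMap.smul_apply, smul_eq_mul, h, mul_assoc]

/-- The vector space `𝒜_1` with the harmonic product. -/
def Harmonic : Type := NCPoly 1

namespace Harmonic

instance : AddCommGroup Harmonic := inferInstanceAs (AddCommGroup (NCPoly 1))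

instance : Module ℚ Harmonic := inferInstanceAs (Module ℚ (NCPoly 1))

/-- The identity map, from `𝒜_1` with the harmonic product to `𝒜_1` with concatenation. -/
def toNC : Harmonic ≃ₗ[ℚ] NCPoly 1 := LinearEquiv.refl ℚ (NCPoly 1)

instance : CommRing Harmonic where
  mul u v := toNC.symm (star 1 (toNC u) (toNC v))
  one := toNC.symm 1
  left_distrib u v w := by
    change toNC.symm (star 1 (toNC u) (toNC (v + w))) = toNC.symm _ + toNC.symm _
    simp only [map_add]
  right_distrib u v w := by
    change toNC.symm (star 1 (toNC (u + v)) (toNC w)) = toNC.symm _ + toNC.symm _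
    simp only [map_add, LinearMap.add_apply]
  zero_mul u := by
    change toNC.symm (star 1 (toNC 0) (toNC u)) = 0
    simp only [map_zero, LinearMap.zero_apply]
  mul_zero u := by
    change toNC.symm (star 1 (toNC u) (toNC 0)) = 0
    simp only [map_zero]
  mul_assoc u v w := star_star 1 (toNC u) (toNC v) (toNC w)
  one_mul u := star_one_left 1 (toNC u)
  mul_one u := (star_one_right 1 (toNC u)).trans (sigma_one_eq _)
  mul_comm u v := star_comm (toNC u) (toNC v)
  zsmul := zsmulRec
  neg_add_cancel := neg_add_cancel

theorem toNC_mul (u v : Harmonic) : toNC (u * v) = star 1 (toNC u) (toNC v) := rfl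

@[simp] theorem toNC_one : toNC 1 = 1 := rfl

instance : Algebra ℚ Harmonic := Algebra.ofModule
  (fun c u v => toNC.injective (by simp only [toNC_mul, map_smul, LinearMap.smul_apply]))
  (fun c u v => toNC.injective (by simp only [toNC_mul, map_smul]))

end Harmonic

/-! ### The operator on `𝒜_r` given by an element of `𝒜_1` -/

/-- The values of `NCPoly.leftAct` on words. -/
def leftActWord : List (Letter r) → NCPoly 1 →ₗ[ℚ] NCPoly r
  | [] => Algebra.linearMap ℚ (NCPoly r) ∘ₗ constTerm.toLinearMap
  | .x :: w => LinearMap.mulLeft ℚ x ∘ₗ leftActWord w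
  | .y s :: w => LinearMap.mulLeft ℚ (x + y s) ∘ₗ (star s).flip (word w)
      - LinearMap.mulLeft ℚ x ∘ₗ leftActWord w

variable (r) in
/-- The operator of `g ∈ 𝒜_1` that commutes with left multiplication by `x` and maps
`(x + y_s) w` to `(x + y_s) (g * w)`. -/
def leftAct : NCPoly 1 →ₗ[ℚ] NCPoly r →ₗ[ℚ] NCPoly r := (onWords leftActWord).flip

theorem leftAct_word (g : NCPoly 1) (l : List (Letter r)) :
    leftAct r g (word l) = leftActWord l g := by
  rw [leftAct, LinearMap.flip_apply, onWords_word]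

@[simp] theorem leftAct_apply_one (g : NCPoly 1) :
    leftAct r g 1 = algebraMap ℚ _ (constTerm g) := by
  rw [← word_nil, leftAct_word]; rfl

@[simp] theorem leftAct_x_mul (g : NCPoly 1) (w : NCPoly r) :
    leftAct r g (x * w) = x * leftAct r g w := by
  induction w using word_induction with
  | word l => rw [x, ← word_cons, leftAct_word, leftAct_word]; rfl
  | add v w hv hw => simp only [mul_add, map_add, hv, hw]
  | smul c w hw => simp only [mul_smul_comm, map_smul, hw]

@[simp] theorem leftAct_z_mul (g : NCPoly 1) (s : Mu r) (w : NCPoly r) :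
    leftAct r g ((x + y s) * w) = (x + y s) * star s g w := by
  induction w using word_induction with
  | word l =>
      rw [add_mul, map_add, leftAct_x_mul, y, ← word_cons, leftAct_word, leftAct_word, leftActWord]
      simp [y]
  | add v w hv hw => simp only [mul_add, map_add, hv, hw]
  | smul c w hw => simp only [mul_smul_comm, map_smul, hw]

@[simp] theorem leftAct_one_left (w : NCPoly r) : leftAct r 1 w = w := by
  induction w using left_induction with
  | one => simp
  | x_mul w hw => rw [leftAct_x_mul, hw]
  | z_mul w t _ => simp
  | add v w hv hw => rw [map_add, hv, hw]
  | smul c w hw => rw [map_smul, hw]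

@[simp] theorem leftAct_mul_x (g : NCPoly 1) (w : NCPoly r) :
    leftAct r g (w * x) = leftAct r g w * x := by
  induction w using left_induction with
  | one =>
      rw [one_mul, ← mul_one x, leftAct_x_mul, leftAct_apply_one, mul_one, Algebra.commutes]
  | x_mul w hw => rw [mul_assoc, leftAct_x_mul, leftAct_x_mul, hw, mul_assoc]
  | z_mul w t _ => rw [mul_assoc, leftAct_z_mul, leftAct_z_mul, star_mul_x_right, mul_assoc]
  | add v w hv hw => simp only [add_mul, map_add, hv, hw]
  | smul c w hw => simp only [smul_mul_assoc, map_smul, hw]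

/-- On left multiples of x + y_t this is the module law; on 1 it is the multiplicativity of the
constant term. -/
theorem leftAct_star (g h : NCPoly 1) (w : NCPoly r) :
    leftAct r (star 1 g h) w = leftAct r g (leftAct r h w) := by
  induction w using left_induction with
  | one =>
      simp only [leftAct_apply_one, constTerm_star, Algebra.algebraMap_eq_smul_one, map_smul,
        smul_smul, mul_comm]
  | x_mul w hw => simp only [leftAct_x_mul, hw]
  | z_mul w t _ => simp only [leftAct_z_mul, star_star]
  | add v w hv hw => simp only [map_add, hv, hw]
  | smul c w hw => simp only [map_smul, hw]

/-! ### The operator corresponding to grafting -/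

/-- Remove the last letter of the words that end in `y`, and delete all other words. -/
def dropY : NCPoly 1 →ₗ[ℚ] NCPoly 1 :=
  onWords fun w => match w.reverse with
    | .y _ :: l => word l.reverse
    | _ => 0

@[simp] theorem dropY_one : dropY 1 = 0 := by
  rw [← word_nil, dropY, onWords_word]; rfl

@[simp] theorem dropY_mul_y (w : NCPoly 1) : dropY (w * y 1) = w := by
  induction w using word_induction with
  | word l => rw [← word_concat_y, dropY, onWords_word]; simp
  | add v w hv hw => rw [add_mul, map_add, hv, hw]
  | smul c w hw => rw [smul_mul_assoc, map_smul, hw]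

/-- The operator with `1 ↦ -y` and `u y ↦ u (x - y) y`. -/
def graftOp : NCPoly 1 →ₗ[ℚ] NCPoly 1 :=
  LinearMap.mulRight ℚ ((x - y 1) * y 1) ∘ₗ dropY
    - LinearMap.mulRight ℚ (y 1) ∘ₗ Algebra.linearMap ℚ (NCPoly 1) ∘ₗ constTerm.toLinearMap

@[simp] theorem graftOp_one : graftOp 1 = - y 1 := by simp [graftOp]

@[simp] theorem graftOp_mul_y (u : NCPoly 1) : graftOp (u * y 1) = u * (x - y 1) * y 1 := by
  simp [graftOp, mul_assoc]

@[simp] theorem constTerm_graftOp (g : NCPoly 1) : constTerm (graftOp g) = 0 := by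
  simp [graftOp]

theorem leftAct_y (g : NCPoly 1) (t : Mu r) :
    leftAct r g (y t) = (x + y t) * sigma t g - x * algebraMap ℚ _ (constTerm g) := by
  have h1 := leftAct_z_mul g t 1
  have h2 := leftAct_x_mul (r := r) g 1
  rw [mul_one, map_add] at h1
  rw [mul_one, leftAct_apply_one] at h2
  rw [← h2, ← star_one_right, ← h1, add_sub_cancel_left]

/-- Up to sign, the case g = 1 of `leftAct_graftOp_mul_y`: there `graftOp` gives -y and q = 0. -/
theorem leftAct_y_mul_y (w : NCPoly r) (t : Mu r) :
    leftAct r (y 1) (w * y t) = leftAct r (y 1) w * y t + w * (x + y t) * y t := by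
  induction w using left_induction with
  | one => simp [leftAct_y]
  | x_mul w hw =>
      rw [mul_assoc, leftAct_x_mul, hw, leftAct_x_mul]; noncomm_ring
  | z_mul w s _ =>
      have h := star_y_y s t 1 w
      rw [one_mul, star_one_left, star_one_left] at h
      rw [mul_assoc, leftAct_z_mul, h, leftAct_z_mul]; noncomm_ring
  | add v w hv hw => simp only [add_mul, map_add] at hv hw ⊢; rw [hv, hw]; abel
  | smul a w hw => simp only [smul_mul_assoc, map_smul, hw, smul_add]

theorem leftAct_mul_y_mul_y (u : NCPoly 1) (w : NCPoly r) (t : Mu r) :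
    ∃ q : NCPoly r,
      leftAct r (u * y 1) (w * y t) = leftAct r (u * y 1) w * y t + q * y t ∧
      leftAct r (u * (x - y 1) * y 1) (w * y t)
        = leftAct r (u * (x - y 1) * y 1) w * y t + q * (x - y t) * y t
          - leftAct r (u * y 1) w * (x + y t) * y t := by
  induction w using left_induction with
  | one => exact ⟨(x + y t) * sigma t u, by simp [leftAct_y, mul_assoc],
      by simp [leftAct_y, mul_assoc]⟩
  | x_mul w hw =>
      obtain ⟨q, h1, h2⟩ := hw
      refine ⟨x * q, ?_, ?_⟩
      · rw [mul_assoc, leftAct_x_mul, leftAct_x_mul, h1]; noncomm_ring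
      · rw [mul_assoc x, leftAct_x_mul, leftAct_x_mul, leftAct_x_mul, h2]; noncomm_ring
  | z_mul w s _ =>
      -- By `star_y_y`, q collects the two terms of uy * wy_t other than (uy * w)y_t.
      refine ⟨(x + y s) * (star s u (w * y t) + star s u w * x), ?_, ?_⟩
      · rw [mul_assoc, leftAct_z_mul, leftAct_z_mul, star_y_y]
        noncomm_ring
      · have h : ∀ v, star s (u * (x - y 1)) v = star s u v * x - star s (u * y 1) v := by
          intro v
          rw [mul_sub, map_sub, LinearMap.sub_apply, star_mul_x_left]
        -- In u(x - y)y * wy_t, the x of x - y comes out as a right factor, while its y requires a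
        -- second use of `star_y_y`. Together they give q the factor x - y_t and leave the
        -- correction -(uy * w)(x + y_t).
        rw [mul_assoc (x + y s), leftAct_z_mul, leftAct_z_mul, leftAct_z_mul, star_y_y, h, h, star_y_y]
        noncomm_ring
  | add v w hv hw =>
      obtain ⟨q, h1, h2⟩ := hv
      obtain ⟨q', h1', h2'⟩ := hw
      refine ⟨q + q', ?_, ?_⟩
      · rw [add_mul, map_add, map_add, h1, h1']; noncomm_ring
      · rw [add_mul, map_add, map_add, map_add, h2, h2']; noncomm_ring
  | smul a w hw =>
      obtain ⟨q, h1, h2⟩ := hw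
      refine ⟨a • q, ?_, ?_⟩
      · simp only [smul_mul_assoc, map_smul, h1, smul_add]
      · simp only [smul_mul_assoc, map_smul, h2, smul_add, smul_sub]

/-- The point is that both formulas share q: the increment for `graftOp g` is determined by that for
g. Everything is linear in g, and the summand c contributes nothing to q. -/
theorem leftAct_graftOp_mul_y (c : ℚ) (u : NCPoly 1) (w : NCPoly r) (t : Mu r) :
    ∃ q : NCPoly r,
      leftAct r (c • 1 + u * y 1) (w * y t) = leftAct r (c • 1 + u * y 1) w * y t + q * y t ∧
      leftAct r (graftOp (c • 1 + u * y 1)) (w * y t)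
        = leftAct r (graftOp (c • 1 + u * y 1)) w * y t + q * (x - y t) * y t
          - leftAct r (c • 1 + u * y 1) w * (x + y t) * y t := by
  obtain ⟨q, h1, h2⟩ := leftAct_mul_y_mul_y u w t
  refine ⟨q, ?_, ?_⟩
  · simp only [map_add, map_smul, LinearMap.add_apply, LinearMap.smul_apply, leftAct_one_left, h1,
      add_mul, smul_mul_assoc, add_assoc]
  · simp only [map_add, map_smul, LinearMap.add_apply, LinearMap.smul_apply, leftAct_one_left,
      graftOp_one, graftOp_mul_y, map_neg, LinearMap.neg_apply, h2, leftAct_y_mul_y, add_mul,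
      smul_mul_assoc, smul_neg, neg_mul, smul_add]
    abel

end NCPoly

/-! ### The element of `𝒜_1` attached to a forest -/

/-- The element of `ℋ` given by an ordered forest of plane trees. -/
def PlaneTree.forest (l : List PlaneTree) : CK :=
  CK.forest ((l.map PlaneTree.toTree : List RTree) : Multiset RTree)

namespace PlaneTree

@[simp] theorem forest_nil : forest [] = 1 := by simp [forest, CK.forest]

@[simp] theorem forest_cons (t : PlaneTree) (l : List PlaneTree) :
    forest (t :: l) = MvPolynomial.X t.toTree * forest l := by simp [forest, CK.forest]

theorem forest_append (l m : List PlaneTree) : forest (l ++ m) = forest l * forest m := by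
  induction l with
  | nil => simp
  | cons t l ih => simp [ih, mul_assoc]

theorem Bplus_forest (l : List PlaneTree) :
    CK.Bplus (forest l) = MvPolynomial.X (node l).toTree := by
  rw [forest, CK.Bplus_forest, RForest.graft_coe]

theorem comul_X_node (l : List PlaneTree) :
    CK.comul (MvPolynomial.X (node l).toTree)
      = (MvPolynomial.X (node l).toTree : CK) ⊗ₜ[ℚ] (1 : CK)
        + TensorProduct.map LinearMap.id CK.Bplus (CK.comul (forest l)) := by
  rw [← Bplus_forest, forest, CK.comul_Bplus_forest]

end PlaneTree

theorem RForest.exists_planeTree (f : RForest) :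
    ∃ l : List PlaneTree, f = ((l.map PlaneTree.toTree : List RTree) : Multiset RTree) := by
  refine ⟨f.toList.map RTree.rep, ?_⟩
  have h : PlaneTree.toTree ∘ RTree.rep = id := funext RTree.toTree_rep
  rw [List.map_map, h, List.map_id, Multiset.coe_toList]

theorem CK.induction {P : CK → Prop} (forest : ∀ l, P (PlaneTree.forest l))
    (add : ∀ f g, P f → P g → P (f + g)) (smul : ∀ (c : ℚ) f, P f → P (c • f)) (f : CK) : P f := by
  have h : f ∈ Submodule.span ℚ (Set.range PlaneTree.forest) := by
    induction f using MvPolynomial.induction_on with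
    | C c =>
        rw [← MvPolynomial.algebraMap_eq, Algebra.algebraMap_eq_smul_one]
        exact Submodule.smul_mem _ _ (Submodule.subset_span ⟨[], PlaneTree.forest_nil⟩)
    | add _ _ h1 h2 => exact add_mem h1 h2
    | mul_X f t h =>
        induction h using Submodule.span_induction with
        | mem _ h =>
            obtain ⟨l, rfl⟩ := h
            refine Submodule.subset_span ⟨t.rep :: l, ?_⟩
            rw [PlaneTree.forest_cons, t.toTree_rep, mul_comm]
        | zero => simp
        | add _ _ _ _ h1 h2 => rw [add_mul]; exact add_mem h1 h2
        | smul c _ _ h => rw [smul_mul_assoc]; exact Submodule.smul_mem _ _ h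
  induction h using Submodule.span_induction with
  | mem _ h => obtain ⟨l, rfl⟩ := h; exact forest l
  | zero => simpa using smul 0 _ (forest [])
  | add _ _ _ _ h1 h2 => exact add _ _ h1 h2
  | smul c _ _ h => exact smul c _ h

open NCPoly

/-- The operator `NCPoly.graftOp` on `𝒜_1` with the harmonic product. -/
def NCPoly.Harmonic.graft : Harmonic →ₗ[ℚ] Harmonic :=
  Harmonic.toNC.symm.toLinearMap ∘ₗ graftOp ∘ₗ Harmonic.toNC.toLinearMap

mutual
/-- The element of `𝒜_1` attached to a plane tree. -/
def PlaneTree.harmonic : PlaneTree → Harmonic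
  | .node l => Harmonic.graft (PlaneTree.harmonicList l)
/-- The multiplicative extension of `PlaneTree.harmonic` to ordered forests. -/
def PlaneTree.harmonicList : List PlaneTree → Harmonic
  | [] => 1
  | t :: l => PlaneTree.harmonic t * PlaneTree.harmonicList l
end

theorem PlaneTree.harmonicList_eq (l : List PlaneTree) :
    PlaneTree.harmonicList l = (l.map PlaneTree.harmonic).prod := by
  induction l with
  | nil => simp [PlaneTree.harmonicList]
  | cons t l ih => simp [PlaneTree.harmonicList, ih]

/-- Commutativity of the harmonic product makes the element independent of the plane embedding. -/
theorem PlaneTree.harmonic_step {a b : PlaneTree} (h : PlaneTree.Step a b) :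
    a.harmonic = b.harmonic := by
  induction h with
  | perm h =>
      rw [harmonic, harmonic, harmonicList_eq, harmonicList_eq,
        (h.map PlaneTree.harmonic).prod_eq]
  | child l h ih => rw [harmonic, harmonic, harmonicList, harmonicList, ih]

/-- The element of `𝒜_1` attached to a rooted tree. -/
def RTree.harmonic : RTree → Harmonic :=
  Quot.lift PlaneTree.harmonic fun _ _ h => PlaneTree.harmonic_step h

namespace CK

/-- The algebra homomorphism from `ℋ` to `𝒜_1` with the harmonic product that transforms `B₊`
into `NCPoly.Harmonic.graft`. -/
def harmonic : CK →ₐ[ℚ] Harmonic :=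
  MvPolynomial.aeval RTree.harmonic

theorem harmonic_X_toTree (t : PlaneTree) :
    harmonic (MvPolynomial.X t.toTree) = t.harmonic := by
  rw [harmonic, MvPolynomial.aeval_X]; rfl

theorem harmonic_forest (l : List PlaneTree) :
    harmonic (PlaneTree.forest l) = PlaneTree.harmonicList l := by
  induction l with
  | nil => simp [PlaneTree.harmonicList]
  | cons t l ih => rw [PlaneTree.forest_cons, map_mul, ih, harmonic_X_toTree,
      PlaneTree.harmonicList]

theorem harmonic_Bplus (f : CK) : harmonic (Bplus f) = Harmonic.graft (harmonic f) := by
  induction f using CK.induction with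
  | forest l => rw [PlaneTree.Bplus_forest, harmonic_X_toTree, harmonic_forest, PlaneTree.harmonic]
  | add f g hf hg => simp only [map_add, hf, hg]
  | smul c f h => simp only [map_smul, h]

/-- The element of `𝒜_1` attached to an element of `ℋ`, as a linear map. -/
def gen : CK →ₗ[ℚ] NCPoly 1 := Harmonic.toNC.toLinearMap ∘ₗ harmonic.toLinearMap

@[simp] theorem gen_one : gen 1 = 1 := by
  change Harmonic.toNC (harmonic 1) = 1
  rw [map_one, Harmonic.toNC_one]

theorem gen_mul (f g : CK) : gen (f * g) = star 1 (gen f) (gen g) := by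
  change Harmonic.toNC (harmonic (f * g)) = _
  rw [map_mul, Harmonic.toNC_mul]; rfl

theorem gen_Bplus (f : CK) : gen (Bplus f) = graftOp (gen f) := by
  change Harmonic.toNC (harmonic (Bplus f)) = _
  rw [harmonic_Bplus]; rfl

-- The elements of forests lie in ℚ ⊕ 𝒜_1 y.

theorem exists_star_eq (c c' : ℚ) (u u' : NCPoly 1) :
    ∃ v, star 1 (c • 1 + u * y 1) (c' • 1 + u' * y 1) = (c * c') • 1 + v * y 1 := by
  refine ⟨c • u' + c' • u + (star 1 u (u' * y 1) + star 1 (u * y 1) u' + star 1 u u' * x), ?_⟩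
  simp only [map_add, map_smul, LinearMap.add_apply, LinearMap.smul_apply, star_y_y,
    star_one_right, star_one_left, sigma_one_eq, add_mul, smul_mul_assoc]
  module

theorem exists_graftOp_eq (c : ℚ) (u : NCPoly 1) :
    ∃ v, graftOp (c • 1 + u * y 1) = v * y 1 :=
  ⟨u * (x - y 1) - c • 1, by
    simp only [map_add, map_smul, graftOp_one, graftOp_mul_y, sub_mul, smul_mul_assoc, one_mul]
    module⟩

theorem exists_gen_eq (f : CK) : ∃ (c : ℚ) (u : NCPoly 1), gen f = c • 1 + u * y 1 := by
  have key : ∀ t : PlaneTree, ∃ (c : ℚ) (u : NCPoly 1),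
      gen (MvPolynomial.X t.toTree) = c • 1 + u * y 1 := by
    intro t
    induction t using PlaneTree.rec (motive_2 := fun l => ∃ (c : ℚ) (u : NCPoly 1),
      gen (PlaneTree.forest l) = c • 1 + u * y 1) with
    | node l h =>
        obtain ⟨c, u, h⟩ := h
        obtain ⟨v, hv⟩ := exists_graftOp_eq c u
        exact ⟨0, v, by rw [← PlaneTree.Bplus_forest, gen_Bplus, h, hv, zero_smul, zero_add]⟩
    | nil => exact ⟨1, 0, by simp⟩
    | cons t l h1 h2 =>
        obtain ⟨c, u, h1⟩ := h1
        obtain ⟨c', u', h2⟩ := h2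
        obtain ⟨v, hv⟩ := exists_star_eq c c' u u'
        exact ⟨_, v, by rw [PlaneTree.forest_cons, gen_mul, h1, h2, hv]⟩
  induction f using MvPolynomial.induction_on with
  | C c =>
      refine ⟨c, 0, ?_⟩
      rw [← MvPolynomial.algebraMap_eq, Algebra.algebraMap_eq_smul_one, map_smul, gen_one]
      simp
  | add f g h1 h2 =>
      obtain ⟨c, u, h1⟩ := h1
      obtain ⟨c', u', h2⟩ := h2
      exact ⟨c + c', u + u', by rw [map_add, h1, h2, add_mul]; module⟩
  | mul_X f t h =>
      obtain ⟨c, u, h⟩ := h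
      obtain ⟨c', u', h'⟩ := key t.rep
      obtain ⟨v, hv⟩ := exists_star_eq c c' u u'
      rw [t.toTree_rep] at h'
      exact ⟨_, v, by rw [gen_mul, h, h', hv]⟩

/-- Some factor is a tree B₊(m), whose element has no constant term, and multiplying by the other
factors creates none. This makes the right division in condition 2 possible. -/
theorem exists_gen_forest_eq {f : RForest} (hf : f ≠ 0) :
    ∃ u : NCPoly 1, gen (forest f) = u * y 1 := by
  obtain ⟨l, rfl⟩ := f.exists_planeTree
  cases l with
  | nil => exact absurd rfl hf
  | cons t l =>
      obtain ⟨m⟩ := t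
      obtain ⟨c, u, h⟩ := exists_gen_eq (PlaneTree.forest m)
      obtain ⟨v, hv⟩ := exists_graftOp_eq c u
      obtain ⟨c', u', h'⟩ := exists_gen_eq (PlaneTree.forest l)
      obtain ⟨a, ha⟩ := exists_star_eq 0 c' v u'
      refine ⟨a, ?_⟩
      rw [zero_smul, zero_add, zero_mul, zero_smul, zero_add] at ha
      change gen (PlaneTree.forest (PlaneTree.node m :: l)) = _
      rw [PlaneTree.forest_cons, gen_mul, ← PlaneTree.Bplus_forest, gen_Bplus, h, hv, h', ha]

end CK

/-! ### The action of forests on `𝒜_r`, and its Leibniz rule -/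

namespace NCPoly

variable {r : ℕ}

variable (r) in
/-- The action of `ℋ` on `𝒜_r` that is conjugate to the rooted tree maps by `φ`. -/
def forestAct : CK →ₗ[ℚ] NCPoly r →ₗ[ℚ] NCPoly r := leftAct r ∘ₗ CK.gen

theorem forestAct_apply (f : CK) (w : NCPoly r) : forestAct r f w = leftAct r (CK.gen f) w := rfl

@[simp] theorem forestAct_one (w : NCPoly r) : forestAct r 1 w = w := by
  rw [forestAct_apply, CK.gen_one, leftAct_one_left]

theorem forestAct_mul (f g : CK) (w : NCPoly r) :
    forestAct r (f * g) w = forestAct r f (forestAct r g w) := by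
  rw [forestAct_apply, CK.gen_mul, leftAct_star]; rfl

theorem forestAct_mul_x (f : CK) (w : NCPoly r) :
    forestAct r f (w * x) = forestAct r f w * x := leftAct_mul_x _ _

theorem forestAct_Bplus_one (f : CK) : forestAct r (CK.Bplus f) 1 = 0 := by
  rw [forestAct_apply, CK.gen_Bplus, leftAct_apply_one, constTerm_graftOp, map_zero]

theorem forestAct_Bplus_mul_y (f : CK) (w : NCPoly r) (t : Mu r) :
    ∃ q : NCPoly r, forestAct r f (w * y t) = forestAct r f w * y t + q * y t ∧
      forestAct r (CK.Bplus f) (w * y t) = forestAct r (CK.Bplus f) w * y t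
        + q * (x - y t) * y t - forestAct r f w * (x + y t) * y t := by
  obtain ⟨c, u, h⟩ := CK.exists_gen_eq f
  simp only [forestAct_apply, CK.gen_Bplus, h]
  exact leftAct_graftOp_mul_y c u w t

theorem y_ne_zero (t : Mu r) : (y t : NCPoly r) ≠ 0 := FreeAlgebra.ι_ne_zero _

/-- The map `f ⊗ g ↦ a(f) b(g)`. -/
abbrev mulMap (a b : CK →ₗ[ℚ] NCPoly r) : CK ⊗[ℚ] CK →ₗ[ℚ] NCPoly r :=
  LinearMap.mul' ℚ (NCPoly r) ∘ₗ TensorProduct.map a b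

/-- The Leibniz rule for the action of `f`. -/
def Leibniz (r : ℕ) (f : CK) : Prop := ∀ v w : NCPoly r,
  forestAct r f (v * w) = mulMap ((forestAct r).flip v) ((forestAct r).flip w) (CK.comul f)

theorem Leibniz.one : Leibniz r 1 := by
  intro v w
  rw [forestAct_one, map_one CK.comul, Algebra.TensorProduct.one_def]
  simp

theorem Leibniz.mul {f g : CK} (hf : Leibniz r f) (hg : Leibniz r g) : Leibniz r (f * g) := by
  intro v w
  rw [forestAct_mul, hg, map_mul]
  generalize CK.comul g = τ
  induction τ with
  | zero => simp
  | add _ _ h1 h2 => simp only [map_add, mul_add, h1, h2]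
  | tmul a b =>
      have e : forestAct r f (mulMap ((forestAct r).flip v) ((forestAct r).flip w) (a ⊗ₜ b))
          = forestAct r f (forestAct r a v * forestAct r b w) := by simp
      rw [e, hf]
      generalize CK.comul f = τ
      induction τ with
      | zero => simp
      | add _ _ h1 h2 => simp only [map_add, add_mul, h1, h2]
      | tmul c d => simp [forestAct_mul]

/-- The relation `forestAct_Bplus_mul_y` is applied to the second tensor factor and summed; this is
possible because it is linear in q. -/
theorem mulMap_Bplus_mul_y (v w : NCPoly r) (t : Mu r) (τ : CK ⊗[ℚ] CK) :
    ∃ q : NCPoly r,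
      mulMap ((forestAct r).flip v) ((forestAct r).flip (w * y t)) τ
        = mulMap ((forestAct r).flip v) ((forestAct r).flip w) τ * y t + q * y t ∧
      mulMap ((forestAct r).flip v) ((forestAct r).flip (w * y t) ∘ₗ CK.Bplus) τ
        = mulMap ((forestAct r).flip v) ((forestAct r).flip w ∘ₗ CK.Bplus) τ * y t
          + q * (x - y t) * y t
          - mulMap ((forestAct r).flip v) ((forestAct r).flip w) τ * (x + y t) * y t := by
  induction τ with
  | zero => exact ⟨0, by simp⟩
  | add _ _ hτ hτ' =>
      obtain ⟨q, h1, h2⟩ := hτ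
      obtain ⟨q', h1', h2'⟩ := hτ'
      refine ⟨q + q', ?_, ?_⟩
      · rw [map_add, map_add, h1, h1']; noncomm_ring
      · rw [map_add, map_add, map_add, h2, h2']; noncomm_ring
  | tmul a b =>
      obtain ⟨q, h1, h2⟩ := forestAct_Bplus_mul_y b w t
      refine ⟨forestAct r a v * q, ?_, ?_⟩
      · simp only [LinearMap.comp_apply, TensorProduct.map_tmul, LinearMap.flip_apply,
          LinearMap.mul'_apply, h1]
        noncomm_ring
      · simp only [LinearMap.comp_apply, TensorProduct.map_tmul, LinearMap.flip_apply,
          LinearMap.mul'_apply, h2]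
        noncomm_ring

/-- Both sides satisfy the same recursion on the last letter of w. For a letter y_t it involves only
the increment q of the operator of f, and the Leibniz rule for f identifies the two increments. -/
theorem Leibniz.graft {l : List PlaneTree} (h : Leibniz r (PlaneTree.forest l)) :
    Leibniz r (MvPolynomial.X (PlaneTree.node l).toTree) := by
  intro v w
  have e : ∀ w, mulMap ((forestAct r).flip v) ((forestAct r).flip w)
      (CK.comul (MvPolynomial.X (PlaneTree.node l).toTree))
      = forestAct r (CK.Bplus (PlaneTree.forest l)) v * w
        + mulMap ((forestAct r).flip v) ((forestAct r).flip w ∘ₗ CK.Bplus)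
            (CK.comul (PlaneTree.forest l)) := by
    intro w
    rw [PlaneTree.comul_X_node, map_add, ← PlaneTree.Bplus_forest]
    congr 1
    · simp
    · generalize CK.comul (PlaneTree.forest l) = τ
      induction τ with
      | zero => simp
      | add _ _ h1 h2 => simp only [map_add, h1, h2]
      | tmul a b => simp
  rw [e, ← PlaneTree.Bplus_forest]
  induction w using right_induction with
  | one =>
      have : (forestAct r).flip 1 ∘ₗ CK.Bplus = 0 := by
        refine LinearMap.ext fun f => ?_; exact forestAct_Bplus_one f
      simp [this]
  | mul_x w hw =>
      have : (forestAct r).flip (w * x) ∘ₗ CK.Bplus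
          = LinearMap.mulRight ℚ x ∘ₗ ((forestAct r).flip w ∘ₗ CK.Bplus) := by
        refine LinearMap.ext fun f => ?_; exact forestAct_mul_x _ w
      rw [← mul_assoc, forestAct_mul_x, hw, this, add_mul, mul_assoc]
      congr 1
      generalize CK.comul (PlaneTree.forest l) = τ
      induction τ with
      | zero => simp
      | add _ _ h1 h2 => simp only [map_add, add_mul, h1, h2]
      | tmul a b => simp [mul_assoc]
  | mul_y w t hw =>
      obtain ⟨q, h1, h2⟩ := mulMap_Bplus_mul_y v w t (CK.comul (PlaneTree.forest l))
      obtain ⟨q', h1', h2'⟩ := forestAct_Bplus_mul_y (PlaneTree.forest l) (v * w) t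
      -- Compare the two expressions for the action of f on vwy_t, then cancel y_t on the right.
      have hq : q' = q := by
        rw [mul_assoc v w, h v (w * y t), h v w, h1] at h1'
        exact (mul_right_cancel₀ (y_ne_zero t) (add_left_cancel h1')).symm
      rw [← mul_assoc, h2', hw, h2, hq, h]
      noncomm_ring
  | add w w' h1 h2 =>
      rw [mul_add, mul_add, map_add, h1, h2, map_add, LinearMap.add_comp, mulMap, mulMap, mulMap,
        TensorProduct.map_add_right, LinearMap.comp_add, LinearMap.add_apply]
      abel
  | smul c w h =>
      rw [mul_smul_comm, mul_smul_comm, map_smul, h, map_smul, LinearMap.smul_comp, mulMap, mulMap,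
        TensorProduct.map_smul_right, LinearMap.comp_smul, LinearMap.smul_apply, smul_add]

theorem leibniz_X_toTree (t : PlaneTree) : Leibniz r (MvPolynomial.X t.toTree) := by
  induction t using PlaneTree.rec (motive_2 := fun l => Leibniz r (PlaneTree.forest l)) with
  | node l h => exact h.graft
  | nil => rw [PlaneTree.forest_nil]; exact Leibniz.one
  | cons t l h1 h2 => rw [PlaneTree.forest_cons]; exact h1.mul h2

theorem leibniz (f : CK) : Leibniz r f := by
  induction f using CK.induction with
  | forest l =>
      induction l with
      | nil => rw [PlaneTree.forest_nil]; exact Leibniz.one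
      | cons t l h => rw [PlaneTree.forest_cons]; exact (leibniz_X_toTree t).mul h
  | add f g h1 h2 => intro v w; simp only [map_add, LinearMap.add_apply, h1 v w, h2 v w]
  | smul c f h => intro v w; simp only [map_smul, LinearMap.smul_apply, h v w]

end NCPoly

/-! ### The number of vertices and the coproduct -/

mutual
/-- The number of vertices of a plane tree. -/
def PlaneTree.nodes : PlaneTree → ℕ
  | .node l => PlaneTree.nodesList l + 1
/-- The number of vertices of an ordered forest. -/
def PlaneTree.nodesList : List PlaneTree → ℕ
  | [] => 0
  | t :: l => PlaneTree.nodes t + PlaneTree.nodesList l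
end

namespace PlaneTree

theorem nodes_pos (t : PlaneTree) : 0 < t.nodes := by
  cases t; rw [nodes]; omega

theorem nodesList_append (l m : List PlaneTree) :
    nodesList (l ++ m) = nodesList l + nodesList m := by
  induction l with
  | nil => simp [nodesList]
  | cons t l ih => simp [nodesList, ih, add_assoc]

theorem nodesList_pos {l : List PlaneTree} (h : l ≠ []) : 0 < nodesList l := by
  cases l with
  | nil => exact absurd rfl h
  | cons t l => have := t.nodes_pos; rw [nodesList]; omega

/-- The homogeneous part of degree `n` of `ℋ ⊗ ℋ`. -/
def homog (n : ℕ) : Submodule ℚ (CK ⊗[ℚ] CK) :=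
  Submodule.span ℚ {τ | ∃ a b, nodesList a + nodesList b = n ∧ forest a ⊗ₜ[ℚ] forest b = τ}

/-- The part of `PlaneTree.homog n` with nonempty forests in the second factor. -/
def homogAug (n : ℕ) : Submodule ℚ (CK ⊗[ℚ] CK) :=
  Submodule.span ℚ
    {τ | ∃ a b, b ≠ [] ∧ nodesList a + nodesList b = n ∧ forest a ⊗ₜ[ℚ] forest b = τ}

theorem homogAug_le_homog (n : ℕ) : homogAug n ≤ homog n :=
  Submodule.span_mono fun _ ⟨a, b, _, h⟩ => ⟨a, b, h⟩

theorem homogAug_mul_homog {m n : ℕ} {σ τ : CK ⊗[ℚ] CK} (hσ : σ ∈ homogAug m)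
    (hτ : τ ∈ homog n) : σ * τ ∈ homogAug (m + n) := by
  have h := Submodule.mul_mem_mul hσ hτ
  rw [homogAug, homog, Submodule.span_mul_span] at h
  refine Submodule.span_mono ?_ h
  rintro _ ⟨_, ⟨a, b, hb, h1, rfl⟩, _, ⟨c, d, h2, rfl⟩, rfl⟩
  refine ⟨a ++ c, b ++ d, by simp [hb], ?_, ?_⟩
  · rw [nodesList_append, nodesList_append]; omega
  · rw [forest_append, forest_append]
    exact (Algebra.TensorProduct.tmul_mul_tmul _ _ _ _).symm

theorem forest_tmul_one_mem_homog (l : List PlaneTree) :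
    forest l ⊗ₜ[ℚ] (1 : CK) ∈ homog (nodesList l) :=
  Submodule.subset_span ⟨l, [], by simp [nodesList], by simp⟩

theorem map_Bplus_mem_homogAug {n : ℕ} {τ : CK ⊗[ℚ] CK} (h : τ ∈ homog n) :
    TensorProduct.map LinearMap.id CK.Bplus τ ∈ homogAug (n + 1) := by
  rw [homog] at h
  induction h using Submodule.span_induction with
  | mem _ h =>
      obtain ⟨a, b, h, rfl⟩ := h
      refine Submodule.subset_span ⟨a, [node b], by simp, ?_, ?_⟩
      · simp only [nodesList, nodes]; omega
      · simp [Bplus_forest]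
  | zero => simp
  | add _ _ _ _ h1 h2 => rw [map_add]; exact add_mem h1 h2
  | smul c _ _ h => rw [map_smul]; exact Submodule.smul_mem _ _ h

theorem comul_forest_mem_homog {l : List PlaneTree}
    (h : CK.comul (forest l) - forest l ⊗ₜ[ℚ] (1 : CK) ∈ homogAug (nodesList l)) :
    CK.comul (forest l) ∈ homog (nodesList l) := by
  have := add_mem (homogAug_le_homog _ h) (forest_tmul_one_mem_homog l)
  rwa [sub_add_cancel] at this

/-- With l also denoting its forest, Δ(tl) - tl ⊗ 1 = (Δ(t) - t ⊗ 1)Δ(l) + (Δ(l) - l ⊗ 1)(t ⊗ 1). -/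
theorem comul_cons_sub_mem {t : PlaneTree} {l : List PlaneTree}
    (ht : CK.comul (MvPolynomial.X t.toTree) - (MvPolynomial.X t.toTree : CK) ⊗ₜ[ℚ] (1 : CK)
      ∈ homogAug t.nodes)
    (hl : CK.comul (forest l) - forest l ⊗ₜ[ℚ] (1 : CK) ∈ homogAug (nodesList l)) :
    CK.comul (forest (t :: l)) - forest (t :: l) ⊗ₜ[ℚ] (1 : CK)
      ∈ homogAug (nodesList (t :: l)) := by
  have h1 := homogAug_mul_homog ht (comul_forest_mem_homog hl)
  have h2 := homogAug_mul_homog hl (forest_tmul_one_mem_homog [t])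
  have e : nodesList l + nodesList [t] = t.nodes + nodesList l := by
    simp only [nodesList]; omega
  rw [e] at h2
  rw [nodesList]
  convert add_mem h1 h2 using 1
  have e' : (forest (t :: l)) ⊗ₜ[ℚ] (1 : CK) = (forest l ⊗ₜ[ℚ] (1 : CK))
      * ((MvPolynomial.X t.toTree : CK) ⊗ₜ[ℚ] (1 : CK)) := by
    rw [Algebra.TensorProduct.tmul_mul_tmul, forest_cons, mul_one, mul_comm]
  rw [e', forest_cons, map_mul, forest_cons, forest_nil, mul_one]
  ring

theorem comul_X_sub_mem (t : PlaneTree) :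
    CK.comul (MvPolynomial.X t.toTree) - (MvPolynomial.X t.toTree : CK) ⊗ₜ[ℚ] (1 : CK)
      ∈ homogAug t.nodes := by
  induction t using PlaneTree.rec (motive_2 := fun l =>
    CK.comul (forest l) - forest l ⊗ₜ[ℚ] (1 : CK) ∈ homogAug (nodesList l)) with
  | node l h =>
      rw [comul_X_node, add_sub_cancel_left, nodes]
      exact map_Bplus_mem_homogAug (comul_forest_mem_homog h)
  | nil => simp [Algebra.TensorProduct.one_def]
  | cons t l h1 h2 => exact comul_cons_sub_mem h1 h2

theorem comul_forest_sub_mem (l : List PlaneTree) :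
    CK.comul (forest l) - forest l ⊗ₜ[ℚ] (1 : CK) ∈ homogAug (nodesList l) := by
  induction l with
  | nil => simp [Algebra.TensorProduct.one_def]
  | cons t l h => exact comul_cons_sub_mem t.comul_X_sub_mem h

end PlaneTree

/-! ### Uniqueness of the rooted tree maps -/

namespace NCPoly

variable {r : ℕ}

theorem x_ne_zero : (x : NCPoly r) ≠ 0 := FreeAlgebra.ι_ne_zero _

theorem z_ne_zero : (z : NCPoly r) ≠ 0 := fun h => x_ne_zero (r := r) (by rw [← phi_z, h, map_zero])

theorem zd_ne_zero (s : Mu r) : zd s ≠ 0 := by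
  intro h
  have h1 : (x + y s : NCPoly r) = 0 := by rw [← phi_zd, h, map_zero]
  have h2 := congrArg (FreeAlgebra.lift ℚ fun a : Letter r => match a with
    | .x => (1 : ℚ)
    | .y _ => 0) h1
  simp [x, y] at h2

theorem z_sub_zd_ne_zero (s : Mu r) : z - zd s ≠ 0 := by
  intro h
  apply y_ne_zero s
  have h1 := congrArg phi h
  rw [map_sub, phi_z, phi_zd, map_zero] at h1
  simpa using h1

theorem x_mem_zLetters : x ∈ zLetters r := Or.inr ⟨1, zd_one⟩

theorem z_mem_zLetters : z ∈ zLetters r := Or.inl rfl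

theorem zd_mem_zLetters (s : Mu r) : zd s ∈ zLetters r := Or.inr ⟨s, rfl⟩

theorem y_mem_span (s : Mu r) : ∃ v ∈ zLetters r, y s = v - x := by
  by_cases hs : s = 1
  · exact ⟨z, z_mem_zLetters, by rw [hs, z]; abel⟩
  · exact ⟨zd s, zd_mem_zLetters s, by rw [zd_of_ne hs]; abel⟩

namespace IsRootedTreeMap

variable {T T' : CK →ₗ[ℚ] Module.End ℚ (NCPoly r)}

theorem map_one (hT : IsRootedTreeMap T) : T 1 = LinearMap.id := by
  rw [← hT.empty]; simp [CK.forest]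

/-- On letters, forests with exactly n vertices are covered too: the single vertex is prescribed,
B₊(f) is determined by f, and a product by its proper factors. -/
theorem eq_on_zLetters (hT : IsRootedTreeMap T) (hT' : IsRootedTreeMap T') {n : ℕ}
    (ih : ∀ l, PlaneTree.nodesList l < n → T (PlaneTree.forest l) = T' (PlaneTree.forest l))
    {l : List PlaneTree} (hl : PlaneTree.nodesList l ≤ n) {v : NCPoly r} (hv : v ∈ zLetters r) :
    T (PlaneTree.forest l) v = T' (PlaneTree.forest l) v := by
  rcases l with _ | ⟨t, _ | ⟨t', l⟩⟩
  · rw [PlaneTree.forest_nil, hT.map_one, hT'.map_one]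
  · obtain ⟨m⟩ := t
    rw [PlaneTree.forest_cons, PlaneTree.forest_nil, mul_one, ← PlaneTree.Bplus_forest]
    rw [PlaneTree.nodesList, PlaneTree.nodes, PlaneTree.nodesList] at hl
    cases m with
    | nil =>
        rcases hv with rfl | ⟨s, rfl⟩
        · exact hT.vertex_z.trans hT'.vertex_z.symm
        · exact (hT.vertex_zd s).trans (hT'.vertex_zd s).symm
    | cons t m =>
        have hm : ((((t :: m).map PlaneTree.toTree : List RTree)) : RForest) ≠ 0 := by simp
        rcases hv with rfl | ⟨s, rfl⟩
        · exact (hT.graft_z _ hm).trans (hT'.graft_z _ hm).symm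
        · obtain ⟨u, h1, h2⟩ := hT.graft_zd _ hm s
          obtain ⟨u', h1', h2'⟩ := hT'.graft_zd _ hm s
          have h := ih (t :: m) (by omega)
          -- The quotient by R_{z - z_s^δ} is unique, as z - z_s^δ is nonzero and 𝒜_r has no zero
          -- divisors.
          have e : u = u' := mul_right_cancel₀ (z_sub_zd_ne_zero s)
            (h1.symm.trans ((LinearMap.congr_fun h _).trans h1'))
          rw [PlaneTree.forest, h2, h2', e]
  · have h1 := t.nodes_pos
    have h2 := t'.nodes_pos
    simp only [PlaneTree.nodesList] at hl
    have e : PlaneTree.forest (t :: t' :: l) = CK.forest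
        ((([t].map PlaneTree.toTree : List RTree) : RForest)
          + (((t' :: l).map PlaneTree.toTree : List RTree) : RForest)) := by
      simp [PlaneTree.forest]
    rw [e, hT.mul _ _ v hv, hT'.mul _ _ v hv]
    have e1 := ih [t] (by simp only [PlaneTree.nodesList]; omega)
    have e2 := ih (t' :: l) (by simp only [PlaneTree.nodesList]; omega)
    rw [PlaneTree.forest] at e1 e2
    rw [e1, e2]

/-- In Δ(f) - f ⊗ 1 every second factor is nonempty, so every first factor is smaller than f. The
second factor may be f itself, but it acts only on the letter v, where `eq_on_zLetters` applies. -/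
theorem sub_mul_eq (hT : IsRootedTreeMap T) (hT' : IsRootedTreeMap T') {l : List PlaneTree}
    (ih : ∀ m, PlaneTree.nodesList m < PlaneTree.nodesList l →
      T (PlaneTree.forest m) = T' (PlaneTree.forest m))
    {v : NCPoly r} (hv : v ∈ zLetters r) (w : NCPoly r) :
    T (PlaneTree.forest l) (w * v) - T' (PlaneTree.forest l) (w * v)
      = (T (PlaneTree.forest l) w - T' (PlaneTree.forest l) w) * v := by
  have h1 := hT.concat ((l.map PlaneTree.toTree : List RTree) : RForest) w v hv
  have h2 := hT'.concat ((l.map PlaneTree.toTree : List RTree) : RForest) w v hv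
  rw [← PlaneTree.forest] at h1 h2
  have key : ∀ τ ∈ PlaneTree.homogAug (PlaneTree.nodesList l),
      mulMap (T.flip w) (T.flip v) τ = mulMap (T'.flip w) (T'.flip v) τ := by
    intro τ hτ
    rw [PlaneTree.homogAug] at hτ
    induction hτ using Submodule.span_induction with
    | mem _ h =>
        obtain ⟨a, b, hb, hab, rfl⟩ := h
        have := PlaneTree.nodesList_pos hb
        have e1 := ih a (by omega)
        have e2 := eq_on_zLetters hT hT' ih (l := b) (by omega) hv
        simp only [LinearMap.comp_apply, TensorProduct.map_tmul, LinearMap.flip_apply,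
          LinearMap.mul'_apply, e1, e2]
    | zero => simp
    | add _ _ _ _ h1 h2 => rw [map_add, map_add, h1, h2]
    | smul c _ _ h => rw [map_smul, map_smul, h]
  have h3 := key _ (PlaneTree.comul_forest_sub_mem l)
  rw [map_sub, map_sub] at h3
  have h4 : ∀ {S : CK →ₗ[ℚ] Module.End ℚ (NCPoly r)}, IsRootedTreeMap S →
      mulMap (S.flip w) (S.flip v) (PlaneTree.forest l ⊗ₜ 1) = S (PlaneTree.forest l) w * v := by
    intro S hS
    simp [hS.map_one]
  rw [h4 hT, h4 hT'] at h3
  rw [h1, h2, sub_mul]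
  exact (sub_eq_sub_iff_sub_eq_sub.mp h3)

theorem unique (hT : IsRootedTreeMap T) (hT' : IsRootedTreeMap T') : T = T' := by
  have key : ∀ n l, PlaneTree.nodesList l = n →
      T (PlaneTree.forest l) = T' (PlaneTree.forest l) := by
    intro n
    induction n using Nat.strong_induction_on with
    | _ n ih =>
      rintro l rfl
      have ih' : ∀ m, PlaneTree.nodesList m < PlaneTree.nodesList l →
          T (PlaneTree.forest m) = T' (PlaneTree.forest m) := fun m hm => ih _ hm m rfl
      have hmul {v : NCPoly r} (hv : v ∈ zLetters r) (w : NCPoly r) :=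
        sub_mul_eq hT hT' ih' hv w
      refine LinearMap.ext fun w => ?_
      induction w using right_induction with
      | one =>
          -- No condition prescribes f̃(1) for nonempty f; it is recovered from f̃(1 · z) by
          -- cancelling z.
          have h := hmul z_mem_zLetters 1
          rw [one_mul, eq_on_zLetters hT hT' ih' le_rfl z_mem_zLetters, sub_self] at h
          exact sub_eq_zero.mp ((mul_eq_zero.mp h.symm).resolve_right z_ne_zero)
      | mul_x w hw =>
          have h := hmul x_mem_zLetters w
          rwa [hw, sub_self, zero_mul, sub_eq_zero] at h
      | mul_y w t hw =>
          obtain ⟨v, hv, e⟩ := y_mem_span t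
          have h := hmul x_mem_zLetters w
          have h' := hmul hv w
          rw [hw, sub_self, zero_mul, sub_eq_zero] at h h'
          rw [e, mul_sub, map_sub, map_sub, h, h']
      | add v w hv hw => rw [map_add, map_add, hv, hw]
      | smul c w hw => rw [map_smul, map_smul, hw]
  refine LinearMap.ext fun f => ?_
  induction f using CK.induction with
  | forest l => exact key _ l rfl
  | add f g hf hg => rw [map_add, map_add, hf, hg]
  | smul c f hf => rw [map_smul, map_smul, hf]

end IsRootedTreeMap

/-! ### Existence of the rooted tree maps -/

variable (r) in
/-- The rooted tree maps. -/
def rootedTreeMap : CK →ₗ[ℚ] Module.End ℚ (NCPoly r) :=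
  ((forestAct r).compl₂ phi.toLinearMap).compr₂ phi.toLinearMap

theorem rootedTreeMap_apply (f : CK) (w : NCPoly r) :
    rootedTreeMap r f w = phi (forestAct r f (phi w)) := rfl

theorem rootedTreeMap_zd_mul (f : CK) (s : Mu r) (w : NCPoly r) :
    rootedTreeMap r f (zd s * w) = zd s * diamond s (phi (CK.gen f)) w := by
  rw [rootedTreeMap_apply, map_mul, phi_zd, forestAct_apply, leftAct_z_mul, star_apply, map_mul,
    phi_x_add_y, phi_phi, phi_phi]

theorem rootedTreeMap_zd (f : CK) (s : Mu r) :
    rootedTreeMap r f (zd s) = zd s * phi (sigma s (CK.gen f)) := by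
  have h := rootedTreeMap_zd_mul f s 1
  rwa [mul_one, diamond_one_right, psi_incl, phi_phi] at h

theorem rootedTreeMap_Bplus_z (f : CK) : rootedTreeMap r (CK.Bplus f) z = 0 := by
  rw [rootedTreeMap_apply, phi_z, ← one_mul x, forestAct_mul_x, forestAct_Bplus_one, zero_mul,
    map_zero]

theorem isRootedTreeMap_rootedTreeMap : IsRootedTreeMap (rootedTreeMap r) where
  empty := LinearMap.ext fun w => by
    have h : CK.forest 0 = 1 := by simp [CK.forest]
    rw [h, rootedTreeMap_apply, forestAct_one, phi_phi, LinearMap.id_apply]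
  vertex_zd s := by
    have h : CK.forest 0 = 1 := by simp [CK.forest]
    rw [h, rootedTreeMap_zd, CK.gen_Bplus, CK.gen_one, graftOp_one, map_neg, map_neg, sigma_y,
      phi_y, neg_sub]
  vertex_z := rootedTreeMap_Bplus_z _
  graft_zd f hf s := by
    obtain ⟨u, hu⟩ := CK.exists_gen_forest_eq hf
    -- The sign comes from φ(y_s) = -(z - z_s^δ).
    refine ⟨-(zd s * phi (sigma s u)), ?_, ?_⟩
    · rw [rootedTreeMap_zd, hu, map_mul, map_mul, sigma_y, phi_y]; noncomm_ring
    · rw [rootedTreeMap_zd, CK.gen_Bplus, hu, graftOp_mul_y]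
      simp only [map_mul, map_sub, sigma_y, sigma_x, phi_y, phi_x]
      noncomm_ring
  graft_z f _ := rootedTreeMap_Bplus_z _
  mul g h v _ := by
    have e : CK.forest (g + h) = CK.forest g * CK.forest h := by simp [CK.forest]
    rw [e, rootedTreeMap_apply, forestAct_mul, rootedTreeMap_apply, rootedTreeMap_apply, phi_phi]
  concat f w v _ := by
    rw [rootedTreeMap_apply, map_mul, leibniz]
    generalize CK.comul (CK.forest f) = τ
    induction τ with
    | zero => simp
    | add _ _ h1 h2 => simp only [map_add, h1, h2]
    | tmul a b => simp [rootedTreeMap_apply]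

-- Membership of F_f in 𝒜_1^1, and its uniqueness.

theorem mul_y_mem_one1 (u : NCPoly r) (s : Mu r) : u * y s ∈ one1 r :=
  Submodule.mem_sup_right (Submodule.mem_iSup_of_mem s ⟨u, rfl⟩)

theorem phi_gen_mem_one1 (f : CK) : phi (CK.gen f) ∈ one1 1 := by
  obtain ⟨c, u, h⟩ := CK.exists_gen_eq f
  rw [h, map_add, map_mul, map_smul, _root_.map_one, phi_y_one, mul_neg]
  exact add_mem
    (Submodule.mem_sup_left (Submodule.smul_mem _ _ (Submodule.mem_span_singleton_self 1)))
    (neg_mem (mul_y_mem_one1 _ _))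

theorem sigma_injective (s : Mu r) : Function.Injective (sigma s) := by
  let p : NCPoly r →ₐ[ℚ] NCPoly 1 := FreeAlgebra.lift ℚ fun
    | .x => x
    | .y _ => y 1
  have h : p.comp (sigma s) = AlgHom.id ℚ _ := by
    ext a
    cases a with
    | x =>
        change p (sigma s x) = x
        rw [sigma_x]; simp [p, x]
    | y t =>
        change p (sigma s (y t)) = y t
        rw [sigma_y, y_eq t]; simp [p, y]
  exact Function.LeftInverse.injective (g := p) (DFunLike.congr_fun h)

/-- The map v ↦ v ◇_s 1 is φ σ_s φ, a composite of injective maps, so testing on w = 1 already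
determines F_f. -/
theorem diamond_one_injective (s : Mu r) {u v : NCPoly 1} (h : diamond s u 1 = diamond s v 1) :
    u = v := by
  rw [diamond_one_right, diamond_one_right, psi_incl, psi_incl] at h
  have phi_inj (n : ℕ) : Function.Injective (phi (r := n)) :=
    Function.LeftInverse.injective phi_phi
  exact phi_inj _ (sigma_injective s (phi_inj _ h))

end NCPoly

end

theorem theorem2p1 (r : ℕ) (hr : 0 < r) :
    (∃! T : CK →ₗ[ℚ] Module.End ℚ (NCPoly r), NCPoly.IsRootedTreeMap T) ∧
    ∀ T : CK →ₗ[ℚ] Module.End ℚ (NCPoly r), NCPoly.IsRootedTreeMap T →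
      ∀ f : CK, ∃! F : NCPoly 1, F ∈ NCPoly.one1 1 ∧
        ∀ (s : Mu r) (w : NCPoly r),
          T f (NCPoly.zd s * w) = NCPoly.zd s * NCPoly.diamond s F w := by
  refine ⟨⟨NCPoly.rootedTreeMap r, NCPoly.isRootedTreeMap_rootedTreeMap, fun T hT =>
    hT.unique NCPoly.isRootedTreeMap_rootedTreeMap⟩, fun T hT f => ?_⟩
  obtain rfl := hT.unique NCPoly.isRootedTreeMap_rootedTreeMap
  refine ⟨NCPoly.phi (CK.gen f), ⟨NCPoly.phi_gen_mem_one1 f, NCPoly.rootedTreeMap_zd_mul f⟩, ?_⟩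
  rintro F ⟨_, hF⟩
  have h := (hF 1 1).symm.trans (NCPoly.rootedTreeMap_zd_mul f 1 1)
  exact NCPoly.diamond_one_injective 1 (mul_left_cancel₀ (NCPoly.zd_ne_zero 1) h)
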